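/- Let $d\ge 0$ be an integer, let $\Omega$ be a bounded open subset of $\mathbb{R}^{d}$, and let $X$ be a reflexive real Banach space with a $1$-symmetric Schauder basis $(e_n)_{n\in\mathbb{N}}$, that is, $\left\|\sum_{n\in F}\theta_n a_n e_{\sigma(n)}\right\|_X=\left\|\sum_{n\in F} a_n e_n\right\|_X$ for every finite $F\subset\mathbb{N}$, all real $(a_n)$, all signs $\theta_n=\pm1$ and every permutation $\sigma$ of $\mathbb{N}$. Let $\mathcal{P}(\Omega)$ be the set of all open parallelepipeds $T=\prod_{i=1}^{d}(\alpha_i,\beta_i)$, $\alpha_i<\beta_i$, with $T\subset\Omega$, and let $JF_X(\Omega)$ be the completion of $L^1(\Omega)$ (real-valued functions, Lebesgue measure $\mu$) under the norm $$\|f\|_{JF_X(\Omega)}=\sup\left\{\left\|\sum_{j=1}^{m}\left(\int_{T_j} f\,d\mu\right)e_j\right\|_X : m\in\mathbb{N},\ T_1,\dots,T_m\in\mathcal{P}(\Omega)\text{ pairwise disjoint}\right\}.$$ Then $\ell_1$ does not embed isomorphically into $JF_X(\Omega)$: no linear subspace of $JF_X(\Omega)$ is linearly homeomorphic to $\ell_1$.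 -/

import Mathlib

open MeasureTheory

noncomputable section

namespace JamesFunctionSpace

/-- A real Banach space `X` is reflexive if the canonical map into its bidual is onto. -/
def IsReflexive (X : Type*) [NormedAddCommGroup X] [NormedSpace ℝ X] : Prop :=
  Function.Surjective (NormedSpace.inclusionInDoubleDual ℝ X)

/-- A `1`-symmetric basis `(e n)` of `X`, indexed by `ℕ`: a Schauder basis whose norm is invariant
under all changes of signs of the coefficients and all permutations of the basis vectors. -/
structure OneSymmetricBasis (X : Type*) [NormedAddCommGroup X] [NormedSpace ℝ X] where
  /-- The underlying Schauder basis. -/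
  toSchauderBasis : SchauderBasis ℝ X
  /-- Invariance of the norm of finite linear combinations. -/
  norm_sum_perm : ∀ (σ : Equiv.Perm ℕ) (θ : ℕ → ℝ), (∀ n, |θ n| = 1) →
    ∀ (s : Finset ℕ) (a : ℕ → ℝ),
      ‖∑ n ∈ s, (θ n * a n) • toSchauderBasis (σ n)‖ = ‖∑ n ∈ s, a n • toSchauderBasis n‖

variable {X : Type*} [NormedAddCommGroup X] [NormedSpace ℝ X]

/-- The `n`-th vector of the basis. -/
def OneSymmetricBasis.e (b : OneSymmetricBasis X) (n : ℕ) : X := b.toSchauderBasis n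

lemma OneSymmetricBasis.norm_e (b : OneSymmetricBasis X) (n : ℕ) : ‖b.e n‖ = ‖b.e 0‖ := by
  have h := b.norm_sum_perm (Equiv.swap 0 n) (fun _ => 1) (by simp) {0} (fun _ => 1)
  simpa [OneSymmetricBasis.e] using h

variable {d : ℕ}

/-- The set of all open parallelepipeds `∏ i, (α i, β i)`, with `α i < β i` for every `i`, that are
contained in `Ω`. -/
def parallelepipeds (Ω : Set (Fin d → ℝ)) : Set (Set (Fin d → ℝ)) :=
  {T | ∃ α β : Fin d → ℝ, (∀ i, α i < β i) ∧
    T = Set.univ.pi (fun i => Set.Ioo (α i) (β i)) ∧ T ⊆ Ω}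

lemma measurableSet_of_mem_parallelepipeds {Ω T : Set (Fin d → ℝ)}
    (hT : T ∈ parallelepipeds Ω) : MeasurableSet T := by
  obtain ⟨α, β, -, rfl, -⟩ := hT
  exact MeasurableSet.univ_pi fun i => measurableSet_Ioo

lemma subset_of_mem_parallelepipeds {Ω T : Set (Fin d → ℝ)}
    (hT : T ∈ parallelepipeds Ω) : T ⊆ Ω := by
  obtain ⟨α, β, -, rfl, h⟩ := hT
  exact h

/-- The space `L¹(Ω)` for Lebesgue measure, as a real vector space which will carry the norm of
`JF_X(Ω)`. The basis `b` occurs as a parameter because that norm depends on it. -/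
def PreJF (_b : OneSymmetricBasis X) (Ω : Set (Fin d → ℝ)) : Type :=
  Lp ℝ 1 (volume.restrict Ω)

instance (b : OneSymmetricBasis X) (Ω : Set (Fin d → ℝ)) : AddCommGroup (PreJF b Ω) :=
  inferInstanceAs (AddCommGroup (Lp ℝ 1 (volume.restrict Ω)))

instance (b : OneSymmetricBasis X) (Ω : Set (Fin d → ℝ)) : Module ℝ (PreJF b Ω) :=
  inferInstanceAs (Module ℝ (Lp ℝ 1 (volume.restrict Ω)))

/-- `PreJF b Ω` is, as a vector space, nothing but `L¹(Ω)`. -/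
def PreJF.toL1 (b : OneSymmetricBasis X) (Ω : Set (Fin d → ℝ)) :
    PreJF b Ω ≃ₗ[ℝ] Lp ℝ 1 (volume.restrict Ω) :=
  LinearEquiv.refl ℝ (Lp ℝ 1 (volume.restrict Ω))

/-- All numbers `‖∑ j, (∫_{T j} f) e j‖_X`, for finite families `T` of pairwise disjoint
parallelepipeds contained in `Ω`. -/
def jfValues (b : OneSymmetricBasis X) (Ω : Set (Fin d → ℝ))
    (f : Lp ℝ 1 (volume.restrict Ω)) : Set ℝ :=
  {r | ∃ (m : ℕ) (T : Fin m → Set (Fin d → ℝ)),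
    (∀ j, T j ∈ parallelepipeds Ω) ∧ Pairwise (fun i j => Disjoint (T i) (T j)) ∧
    r = ‖∑ j, (∫ x in T j, f x) • b.e j‖}

/-- The norm of `JF_X(Ω)` on `L¹(Ω)`. -/
def jfNorm (b : OneSymmetricBasis X) (Ω : Set (Fin d → ℝ))
    (f : Lp ℝ 1 (volume.restrict Ω)) : ℝ :=
  sSup (jfValues b Ω f)

lemma integrableOn_of_subset {Ω T : Set (Fin d → ℝ)} (hT : T ⊆ Ω)
    (f : Lp ℝ 1 (volume.restrict Ω)) : IntegrableOn f T :=
  (L1.integrable_coeFn f).mono_measure (Measure.restrict_mono hT le_rfl)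

lemma setIntegral_add_of_subset {Ω T : Set (Fin d → ℝ)} (hT : T ⊆ Ω)
    (f g : Lp ℝ 1 (volume.restrict Ω)) :
    ∫ x in T, (f + g : Lp ℝ 1 (volume.restrict Ω)) x = (∫ x in T, f x) + ∫ x in T, g x := by
  rw [← integral_add (integrableOn_of_subset hT f) (integrableOn_of_subset hT g)]
  exact integral_congr_ae
    ((Lp.coeFn_add f g).filter_mono (ae_mono (Measure.restrict_mono hT le_rfl)))

lemma setIntegral_smul_of_subset {Ω T : Set (Fin d → ℝ)} (hT : T ⊆ Ω)
    (c : ℝ) (f : Lp ℝ 1 (volume.restrict Ω)) :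
    ∫ x in T, (c • f : Lp ℝ 1 (volume.restrict Ω)) x = c * ∫ x in T, f x := by
  rw [← integral_const_mul]
  exact integral_congr_ae
    ((Lp.coeFn_smul c f).filter_mono (ae_mono (Measure.restrict_mono hT le_rfl)))

lemma zero_mem_jfValues (b : OneSymmetricBasis X) (Ω : Set (Fin d → ℝ))
    (f : Lp ℝ 1 (volume.restrict Ω)) : 0 ∈ jfValues b Ω f :=
  ⟨0, fun j => j.elim0, fun j => j.elim0, fun j => j.elim0, by simp⟩

/-- The supremum is finite: the norm of `JF_X(Ω)` is at most `‖e 0‖ * ‖f‖₁`. -/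
lemma le_of_mem_jfValues (b : OneSymmetricBasis X) (Ω : Set (Fin d → ℝ))
    (f : Lp ℝ 1 (volume.restrict Ω)) {r : ℝ} (hr : r ∈ jfValues b Ω f) :
    r ≤ (∫ x in Ω, ‖f x‖) * ‖b.e 0‖ := by
  obtain ⟨m, T, hT, hd, rfl⟩ := hr
  have hsub : (⋃ j, T j) ⊆ Ω := Set.iUnion_subset fun j => subset_of_mem_parallelepipeds (hT j)
  have hf : Integrable (fun x => ‖f x‖) (volume.restrict Ω) := (L1.integrable_coeFn f).norm
  calc ‖∑ j, (∫ x in T j, f x) • b.e j‖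
      ≤ ∑ j, (∫ x in T j, ‖f x‖) * ‖b.e 0‖ := by
        refine norm_sum_le_of_le _ fun j _ => ?_
        rw [norm_smul, b.norm_e]
        exact mul_le_mul_of_nonneg_right (norm_integral_le_integral_norm _) (norm_nonneg _)
    _ = (∫ x in ⋃ j, T j, ‖f x‖) * ‖b.e 0‖ := by
        rw [← Finset.sum_mul, integral_iUnion_fintype
          (fun j => measurableSet_of_mem_parallelepipeds (hT j)) hd
          (fun j => (integrableOn_of_subset (subset_of_mem_parallelepipeds (hT j)) f).norm)]
    _ ≤ (∫ x in Ω, ‖f x‖) * ‖b.e 0‖ := by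
        refine mul_le_mul_of_nonneg_right ?_ (norm_nonneg _)
        exact integral_mono_measure (Measure.restrict_mono hsub le_rfl)
          (Filter.Eventually.of_forall fun x => norm_nonneg _) hf

lemma bddAbove_jfValues (b : OneSymmetricBasis X) (Ω : Set (Fin d → ℝ))
    (f : Lp ℝ 1 (volume.restrict Ω)) : BddAbove (jfValues b Ω f) :=
  ⟨_, fun _ hr => le_of_mem_jfValues b Ω f hr⟩

lemma jfNorm_nonneg (b : OneSymmetricBasis X) (Ω : Set (Fin d → ℝ))
    (f : Lp ℝ 1 (volume.restrict Ω)) : 0 ≤ jfNorm b Ω f :=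
  le_csSup (bddAbove_jfValues b Ω f) (zero_mem_jfValues b Ω f)

lemma jfNorm_add_le (b : OneSymmetricBasis X) (Ω : Set (Fin d → ℝ))
    (f g : Lp ℝ 1 (volume.restrict Ω)) : jfNorm b Ω (f + g) ≤ jfNorm b Ω f + jfNorm b Ω g := by
  refine csSup_le ⟨0, zero_mem_jfValues b Ω _⟩ ?_
  rintro r ⟨m, T, hT, hd, rfl⟩
  have : ∑ j, (∫ x in T j, (f + g : Lp ℝ 1 (volume.restrict Ω)) x) • b.e j =
      (∑ j, (∫ x in T j, f x) • b.e j) + ∑ j, (∫ x in T j, g x) • b.e j := by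
    rw [← Finset.sum_add_distrib]
    refine Finset.sum_congr rfl fun j _ => ?_
    rw [setIntegral_add_of_subset (subset_of_mem_parallelepipeds (hT j)), add_smul]
  rw [this]
  exact (norm_add_le _ _).trans (add_le_add
    (le_csSup (bddAbove_jfValues b Ω f) ⟨m, T, hT, hd, rfl⟩)
    (le_csSup (bddAbove_jfValues b Ω g) ⟨m, T, hT, hd, rfl⟩))

lemma jfNorm_smul_le (b : OneSymmetricBasis X) (Ω : Set (Fin d → ℝ)) (c : ℝ)
    (f : Lp ℝ 1 (volume.restrict Ω)) : jfNorm b Ω (c • f) ≤ ‖c‖ * jfNorm b Ω f := by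
  refine csSup_le ⟨0, zero_mem_jfValues b Ω _⟩ ?_
  rintro r ⟨m, T, hT, hd, rfl⟩
  have : ∑ j, (∫ x in T j, (c • f : Lp ℝ 1 (volume.restrict Ω)) x) • b.e j =
      c • ∑ j, (∫ x in T j, f x) • b.e j := by
    rw [Finset.smul_sum]
    refine Finset.sum_congr rfl fun j _ => ?_
    rw [setIntegral_smul_of_subset (subset_of_mem_parallelepipeds (hT j)), mul_smul]
  rw [this, norm_smul]
  exact mul_le_mul_of_nonneg_left
    (le_csSup (bddAbove_jfValues b Ω f) ⟨m, T, hT, hd, rfl⟩) (norm_nonneg _)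

lemma jfNorm_zero (b : OneSymmetricBasis X) (Ω : Set (Fin d → ℝ)) :
    jfNorm b Ω (0 : Lp ℝ 1 (volume.restrict Ω)) = 0 := by
  refine le_antisymm ?_ (jfNorm_nonneg b Ω _)
  simpa using jfNorm_smul_le b Ω 0 (0 : Lp ℝ 1 (volume.restrict Ω))

/-- `jfNorm` as a seminorm on `L¹(Ω)`. -/
def jfSeminorm (b : OneSymmetricBasis X) (Ω : Set (Fin d → ℝ)) : Seminorm ℝ (PreJF b Ω) :=
  Seminorm.ofSMulLE (fun f => jfNorm b Ω (PreJF.toL1 b Ω f))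
    (jfNorm_zero b Ω) (jfNorm_add_le b Ω) (jfNorm_smul_le b Ω)

instance (b : OneSymmetricBasis X) (Ω : Set (Fin d → ℝ)) :
    SeminormedAddCommGroup (PreJF b Ω) :=
  (jfSeminorm b Ω).toAddGroupSeminorm.toSeminormedAddCommGroup

lemma PreJF.norm_def (b : OneSymmetricBasis X) (Ω : Set (Fin d → ℝ)) (f : PreJF b Ω) :
    ‖f‖ = jfNorm b Ω (PreJF.toL1 b Ω f) := rfl

instance (b : OneSymmetricBasis X) (Ω : Set (Fin d → ℝ)) : NormedSpace ℝ (PreJF b Ω) where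
  norm_smul_le c f := jfNorm_smul_le b Ω c (PreJF.toL1 b Ω f)

/-- The Banach space `JF_X(Ω)`: the completion of `L¹(Ω)` under the norm `jfNorm`. -/
abbrev JF (b : OneSymmetricBasis X) (Ω : Set (Fin d → ℝ)) : Type :=
  UniformSpace.Completion (PreJF b Ω)

/-- The Banach space `ℓ₁` of absolutely summable real sequences. -/
abbrev Ell1 : Type := lp (fun _ : ℕ => ℝ) 1

/-- `E` contains an isomorphic copy of `F`: some linear subspace of `E` is linearly homeomorphic
to `F`. -/
def ContainsIsomorphicCopy (E F : Type*) [NormedAddCommGroup E] [NormedSpace ℝ E]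
    [NormedAddCommGroup F] [NormedSpace ℝ F] : Prop :=
  ∃ Y : Submodule ℝ E, Nonempty (F ≃L[ℝ] Y)

end JamesFunctionSpace

end

open MeasureTheory Filter Topology

noncomputable section

namespace JamesFunctionSpace

section

/-- A positive linear functional on `C(K)`, `K` compact, is integration against a finite measure. -/
lemma exists_measure_of_positive {K : Type*} [TopologicalSpace K] [CompactSpace K] [T2Space K]
    [MeasurableSpace K] [BorelSpace K] (Λ : C(K, ℝ) →ₗ[ℝ] ℝ) (hΛ : ∀ g, 0 ≤ g → 0 ≤ Λ g) :
    ∃ μ : Measure K, IsFiniteMeasure μ ∧ ∀ g : C(K, ℝ), ∫ x, g x ∂μ = Λ g := by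
  let L : CompactlySupportedContinuousMap K ℝ →ₗ[ℝ] ℝ :=
    { toFun := fun g => Λ g.toContinuousMap
      map_add' := fun g g' => map_add Λ g.toContinuousMap g'.toContinuousMap
      map_smul' := fun c g => map_smul Λ c g.toContinuousMap }
  let P : CompactlySupportedContinuousMap K ℝ →ₚ[ℝ] ℝ := PositiveLinearMap.mk₀ L
    fun g hg => hΛ _ fun x => hg x
  refine ⟨RealRMK.rieszMeasure P, inferInstance, fun g => ?_⟩
  exact RealRMK.integral_rieszMeasure P (CompactlySupportedContinuousMap.continuousMapEquiv g)

/-- A bounded pointwise null sequence in `C(K)` has convex combinations, even of absolute values,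
that are uniformly small. -/
lemma exists_convexCombination_abs_lt {K : Type*} [TopologicalSpace K] [CompactSpace K] [T2Space K]
    (h : ℕ → C(K, ℝ)) (C : ℝ) (hC : ∀ n k, |h n k| ≤ C)
    (h0 : ∀ k, Tendsto (fun n => h n k) atTop (𝓝 0)) {ε : ℝ} (hε : 0 < ε) :
    ∃ (ι : Type) (_ : Fintype ι) (w : ι → ℝ) (n : ι → ℕ), (∀ i, 0 ≤ w i) ∧ ∑ i, w i = 1 ∧
      ∀ k, ∑ i, w i * |h (n i) k| < ε := by
  by_contra hcon
  have hopen : IsOpen {g : C(K, ℝ) | ∀ k, g k < ε} := by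
    have := ContinuousMap.isOpen_setOfPred_mapsTo (X := K) (Y := ℝ) isCompact_univ (isOpen_Iio (a := ε))
    simpa [Set.MapsTo] using this
  have hconv : Convex ℝ {g : C(K, ℝ) | ∀ k, g k < ε} := by
    intro g hg g' hg' a b ha hb hab k
    exact (convex_Iio ε) (hg k) (hg' k) ha hb hab
  have hdisj : Disjoint {g : C(K, ℝ) | ∀ k, g k < ε}
      (convexHull ℝ (Set.range fun n => |h n|)) := by
    rw [Set.disjoint_left]
    intro g hg hg'
    rw [mem_convexHull_iff_exists_fintype] at hg'
    obtain ⟨ι, _, w, z, hw, hw1, hz, rfl⟩ := hg'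
    choose n hn using hz
    refine hcon ⟨ι, inferInstance, w, n, hw, hw1, fun k => ?_⟩
    have := hg k
    simpa [← hn] using this
  obtain ⟨Λ, u, hΛ1, hΛ2⟩ := geometric_hahn_banach_open hconv hopen (convex_convexHull ℝ _) hdisj
  have hu : 0 < u := by simpa using hΛ1 0 (fun k => by simpa using hε)
  have hpos : ∀ g, 0 ≤ g → 0 ≤ Λ g := by
    intro g hg
    by_contra hneg
    push Not at hneg
    have h1 := hΛ1 ((u / Λ g) • g) fun k => by
      have : (u / Λ g) * g k ≤ 0 :=
        mul_nonpos_of_nonpos_of_nonneg (div_nonpos_of_nonneg_of_nonpos hu.le hneg.le) (hg k)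
      simpa using this.trans_lt hε
    rw [map_smul, smul_eq_mul, div_mul_cancel₀ _ hneg.ne] at h1
    exact lt_irrefl _ h1
  let _ : MeasurableSpace K := borel K
  have : BorelSpace K := ⟨rfl⟩
  obtain ⟨μ, hμ, hint⟩ := exists_measure_of_positive Λ.toLinearMap hpos
  have hlim : Tendsto (fun n => ∫ x, |h n| x ∂μ) atTop (𝓝 (∫ _, (0 : ℝ) ∂μ)) := by
    refine tendsto_integral_of_dominated_convergence (fun _ => C)
      (fun n => (|h n|).continuous.aestronglyMeasurable) (integrable_const C)
      (fun n => Eventually.of_forall fun k => by simpa using hC n k)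
      (Eventually.of_forall fun k => ?_)
    simpa using (h0 k).abs
  rw [integral_zero] at hlim
  refine absurd (ge_of_tendsto' hlim fun n => ?_) (not_le.2 hu)
  rw [hint]
  exact hΛ2 _ (subset_convexHull ℝ _ ⟨n, rfl⟩)

/-- Bounded families of functionals converge weakly-star along ultrafilters. -/
lemma exists_weakStar_limit {E : Type*} [NormedAddCommGroup E] [NormedSpace ℝ E] (U : Ultrafilter ℕ)
    (φ : ℕ → StrongDual ℝ E) (C : ℝ) (hφ : ∀ n, ‖φ n‖ ≤ C) :
    ∃ ψ : StrongDual ℝ E, ∀ x, Tendsto (fun n => φ n x) U (𝓝 (ψ x)) := by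
  have hc := WeakDual.isCompact_closedBall (𝕜 := ℝ) (E := E) 0 C
  obtain ⟨ψ, -, hψ⟩ := hc.ultrafilter_le_nhds
    (U.map fun n => StrongDual.toWeakDual (φ n)) (by
      rw [le_principal_iff]
      exact Filter.mem_map.2 (Eventually.of_forall fun n => by simpa using hφ n))
  refine ⟨WeakDual.toStrongDual ψ, fun x => ?_⟩
  exact ((WeakDual.eval_continuous x).tendsto ψ).comp hψ

/-- Bounded sequences of a reflexive space converge weakly along ultrafilters. -/
lemma IsReflexive.exists_weak_limit {E : Type*} [NormedAddCommGroup E] [NormedSpace ℝ E]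
    (hE : IsReflexive E) (U : Ultrafilter ℕ) (u : ℕ → E) (C : ℝ) (hu : ∀ n, ‖u n‖ ≤ C) :
    ∃ x : E, ∀ φ : StrongDual ℝ E, Tendsto (fun n => φ (u n)) U (𝓝 (φ x)) := by
  obtain ⟨ψ, hψ⟩ := exists_weakStar_limit U
    (fun n => NormedSpace.inclusionInDoubleDual ℝ E (u n)) C
    (fun n => (NormedSpace.double_dual_bound ℝ E (u n)).trans (hu n))
  obtain ⟨x, rfl⟩ := hE ψ
  exact ⟨x, hψ⟩

end

section

variable {X : Type*} [NormedAddCommGroup X] [NormedSpace ℝ X]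

namespace OneSymmetricBasis

variable (b : OneSymmetricBasis X)

/-- The coordinate functionals of the basis. -/
def coord (n : ℕ) : StrongDual ℝ X := b.toSchauderBasis.coord n

lemma coord_e (i j : ℕ) : b.coord i (b.e j) = if i = j then 1 else 0 := by
  rw [coord, e, b.toSchauderBasis.ortho]
  by_cases h : i = j
  · subst h; simp
  · simp [h]

lemma tendsto_sum_coord (x : X) :
    Tendsto (fun n => ∑ i ∈ Finset.range n, b.coord i x • b.e i) atTop (𝓝 x) := by
  simpa using! SchauderBasis.tendsto_proj b.toSchauderBasis x

lemma eq_zero_of_coord {x : X} (h : ∀ n, b.coord n x = 0) : x = 0 := by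
  refine tendsto_nhds_unique (b.tendsto_sum_coord x) ?_
  simp [h]

lemma e_ne_zero (n : ℕ) : b.e n ≠ 0 := by
  intro h
  have := b.coord_e n n
  simp [h] at this

lemma norm_sum_perm_e (σ : Equiv.Perm ℕ) (θ : ℕ → ℝ) (hθ : ∀ n, |θ n| = 1) (s : Finset ℕ)
    (a : ℕ → ℝ) : ‖∑ n ∈ s, (θ n * a n) • b.e (σ n)‖ = ‖∑ n ∈ s, a n • b.e n‖ :=
  b.norm_sum_perm σ θ hθ s a

lemma norm_sum_abs (s : Finset ℕ) (a : ℕ → ℝ) :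
    ‖∑ n ∈ s, |a n| • b.e n‖ = ‖∑ n ∈ s, a n • b.e n‖ := by
  rw [← b.norm_sum_perm_e (Equiv.refl ℕ) (fun n => if 0 ≤ a n then 1 else -1)
    (fun n => by split_ifs <;> simp) s a]
  congr 1
  refine Finset.sum_congr rfl fun n _ => ?_
  by_cases h : 0 ≤ a n
  · simp [h, abs_of_nonneg h]
  · simp [h, abs_of_neg (not_le.1 h)]

lemma norm_sum_le_of_subset {s t : Finset ℕ} (hst : s ⊆ t) (a : ℕ → ℝ) :
    ‖∑ n ∈ s, a n • b.e n‖ ≤ ‖∑ n ∈ t, a n • b.e n‖ := by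
  have h := b.norm_sum_perm_e (Equiv.refl ℕ) (fun n => if n ∈ s then 1 else -1)
    (fun n => by split_ifs <;> simp) t a
  have h2 : (2 : ℝ) • ∑ n ∈ s, a n • b.e n = ∑ n ∈ t, a n • b.e n +
      ∑ n ∈ t, ((if n ∈ s then 1 else -1) * a n) • b.e (Equiv.refl ℕ n) := by
    rw [← Finset.sum_add_distrib, Finset.smul_sum, ← Finset.sum_subset hst]
    · refine Finset.sum_congr rfl fun n hn => ?_
      simp [hn, two_smul]
    · intro n _ hn
      simp [hn]
  have h3 := norm_add_le (∑ n ∈ t, a n • b.e n)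
    (∑ n ∈ t, ((if n ∈ s then 1 else -1) * a n) • b.e (Equiv.refl ℕ n))
  rw [← h2, norm_smul, Real.norm_two, h] at h3
  linarith

lemma norm_sum_coord_le (s : Finset ℕ) (x : X) : ‖∑ n ∈ s, b.coord n x • b.e n‖ ≤ ‖x‖ := by
  refine ge_of_tendsto (b.tendsto_sum_coord x).norm ?_
  obtain ⟨N, hN⟩ := s.exists_nat_subset_range
  filter_upwards [eventually_ge_atTop N] with n hn
  exact b.norm_sum_le_of_subset (hN.trans (Finset.range_subset_range.2 hn)) _

/-- The contraction `x ↦ ∑ j ∈ s, θ j * x j * e (σ j)`. -/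
def signPerm (s : Finset ℕ) (θ : ℕ → ℝ) (σ : ℕ → ℕ) : X →L[ℝ] X :=
  ∑ j ∈ s, (b.coord j).smulRight (θ j • b.e (σ j))

lemma signPerm_apply (s : Finset ℕ) (θ : ℕ → ℝ) (σ : ℕ → ℕ) (x : X) :
    b.signPerm s θ σ x = ∑ j ∈ s, (θ j * b.coord j x) • b.e (σ j) := by
  simp [signPerm, smul_smul, mul_comm]

lemma signPerm_e_of_mem {s : Finset ℕ} {j : ℕ} (hj : j ∈ s) (θ : ℕ → ℝ) (σ : ℕ → ℕ) :
    b.signPerm s θ σ (b.e j) = θ j • b.e (σ j) := by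
  simp [signPerm_apply, coord_e, hj]

lemma signPerm_e_of_notMem {s : Finset ℕ} {j : ℕ} (hj : j ∉ s) (θ : ℕ → ℝ) (σ : ℕ → ℕ) :
    b.signPerm s θ σ (b.e j) = 0 := by
  simp [signPerm_apply, coord_e, hj]

lemma norm_signPerm_le (s : Finset ℕ) (θ : ℕ → ℝ) (hθ : ∀ n, |θ n| = 1) (σ : Equiv.Perm ℕ) :
    ‖b.signPerm s θ σ‖ ≤ 1 := by
  refine ContinuousLinearMap.opNorm_le_bound _ zero_le_one fun x => ?_
  rw [signPerm_apply, b.norm_sum_perm_e σ θ hθ, one_mul]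
  exact b.norm_sum_coord_le s x

lemma _root_.Finset.exists_perm_extending {α : Type*} [DecidableEq α] (s : Finset α) (τ : α → α)
    (hτ : Set.InjOn τ s) : ∃ σ : Equiv.Perm α, ∀ j ∈ s, σ j = τ j := by
  induction s using Finset.induction_on with
  | empty => exact ⟨1, by simp⟩
  | insert m s hm ih =>
    obtain ⟨σ, hσ⟩ := ih (hτ.mono (by simp))
    refine ⟨σ.trans (Equiv.swap (σ m) (τ m)), fun j hj => ?_⟩
    rcases Finset.mem_insert.1 hj with rfl | hjs
    · simp
    · have hjm : j ≠ m := fun h => hm (h ▸ hjs)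
      have h1 : σ j ≠ σ m := fun h => hjm (σ.injective h)
      have h2 : σ j ≠ τ m := by
        rw [hσ j hjs]
        exact fun h => hjm (hτ (by simp [hjs]) (by simp) h)
      rw [Equiv.trans_apply, Equiv.swap_apply_of_ne_of_ne h1 h2, hσ j hjs]

lemma norm_sum_injOn (s : Finset ℕ) (τ : ℕ → ℕ) (hτ : Set.InjOn τ s) (a : ℕ → ℝ) :
    ‖∑ n ∈ s, a n • b.e (τ n)‖ = ‖∑ n ∈ s, a n • b.e n‖ := by
  obtain ⟨σ, hσ⟩ := s.exists_perm_extending τ hτ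
  rw [← b.norm_sum_perm_e σ (fun _ => 1) (by simp) s a]
  congr 1
  exact Finset.sum_congr rfl fun n hn => by rw [hσ n hn, one_mul]

lemma tendsto_coord (x : X) : Tendsto (fun n => b.coord n x) atTop (𝓝 0) := by
  have h := ((b.tendsto_sum_coord x).comp (tendsto_add_atTop_nat 1)).sub (b.tendsto_sum_coord x)
  simp only [Function.comp_def, Finset.sum_range_succ, add_sub_cancel_left, sub_self] at h
  have h2 := h.norm
  simp only [norm_smul, b.norm_e, norm_zero] at h2
  have h3 := h2.div_const ‖b.e 0‖
  simp only [mul_div_cancel_right₀ _ (norm_ne_zero_iff.2 (b.e_ne_zero 0)), zero_div] at h3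
  exact tendsto_zero_iff_norm_tendsto_zero.2 h3

variable (hX : IsReflexive X)
include hX

lemma tendsto_dual_e (φ : StrongDual ℝ X) : Tendsto (fun n => φ (b.e n)) atTop (𝓝 0) := by
  rw [tendsto_iff_ultrafilter]
  intro U hU
  obtain ⟨x, hx⟩ := hX.exists_weak_limit U b.e ‖b.e 0‖ fun n => (b.norm_e n).le
  have : x = 0 := b.eq_zero_of_coord fun j => by
    refine tendsto_nhds_unique (hx (b.coord j)) (tendsto_const_nhds.congr' ?_)
    filter_upwards [hU (eventually_gt_atTop j)] with n hn
    rw [coord_e, if_neg hn.ne]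
  simpa [this, Tendsto] using hx φ

/-- Vectors in a ball of `X` have a uniformly bounded number of large coordinates. -/
lemma exists_card_bound {ε : ℝ} (hε : 0 < ε) (C : ℝ) :
    ∃ N : ℕ, ∀ x : ℕ → ℝ, ‖∑ j ∈ Finset.range N, x j • b.e j‖ ≤ C → ∃ j < N, |x j| < ε := by
  by_contra! hcon
  choose x hxC hx using hcon
  obtain ⟨y, hy⟩ := hX.exists_weak_limit (hyperfilter ℕ)
    (fun N => ∑ j ∈ Finset.range N, |x N j| • b.e j) C
    (fun N => by rw [b.norm_sum_abs]; exact hxC N)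
  have hge : ∀ j, ε ≤ b.coord j y := by
    intro j
    refine ge_of_tendsto (hy (b.coord j)) ?_
    filter_upwards [Nat.hyperfilter_le_atTop (eventually_gt_atTop j)] with N hN
    have : b.coord j (∑ i ∈ Finset.range N, |x N i| • b.e i) = |x N j| := by
      simp [coord_e, hN]
    rw [this]
    exact hx N j hN
  exact absurd (ge_of_tendsto' (b.tendsto_coord y) hge) (not_le.2 hε)

/-- Functionals in the ball of the dual have a uniformly bounded number of large coordinates. -/
lemma exists_dual_card_bound {ε : ℝ} (hε : 0 < ε) :
    ∃ N : ℕ, ∀ φ : StrongDual ℝ X, ‖φ‖ ≤ 1 → ∃ j < N, |φ (b.e j)| < ε := by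
  by_contra! hcon
  choose φ hφ1 hφ using hcon
  let θ : ℕ → ℕ → ℝ := fun N n => if 0 ≤ φ N (b.e n) then 1 else -1
  have hθ : ∀ N n, |θ N n| = 1 := fun N n => by
    simp only [θ]; split_ifs <;> simp
  obtain ⟨ψ, hψ⟩ := exists_weakStar_limit (hyperfilter ℕ)
    (fun N => (φ N).comp (b.signPerm (Finset.range N) (θ N) (Equiv.refl ℕ))) 1
    (fun N => (ContinuousLinearMap.opNorm_comp_le _ _).trans
      (mul_le_one₀ (hφ1 N) (norm_nonneg _) (b.norm_signPerm_le _ _ (hθ N) _)))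
  have hge : ∀ j, ε ≤ ψ (b.e j) := by
    intro j
    refine ge_of_tendsto (hψ (b.e j)) ?_
    filter_upwards [Nat.hyperfilter_le_atTop (eventually_gt_atTop j)] with N hN
    rw [ContinuousLinearMap.comp_apply, b.signPerm_e_of_mem (Finset.mem_range.2 hN), map_smul,
      smul_eq_mul]
    refine (hφ N j hN).trans (le_of_eq ?_)
    simp only [θ, Equiv.refl_apply]
    split_ifs with h
    · rw [abs_of_nonneg h, one_mul]
    · rw [abs_of_neg (not_le.1 h), neg_one_mul]
  exact absurd (ge_of_tendsto' (b.tendsto_dual_e hX ψ) hge) (not_le.2 hε)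

/-- The basis is shrinking. -/
lemma exists_tail_le (φ : StrongDual ℝ X) {δ : ℝ} (hδ : 0 < δ) :
    ∃ J : ℕ, ∀ (s : Finset ℕ), (∀ j ∈ s, J ≤ j) → ∀ c : ℕ → ℝ,
      |∑ j ∈ s, φ (b.e j) * c j| ≤ δ * ‖∑ j ∈ s, c j • b.e j‖ := by
  by_contra! hcon
  choose s hs c hc using hcon
  let u : ℕ → X := fun J => ∑ j ∈ s J, c J j • b.e j
  have hφu : ∀ J, φ (u J) = ∑ j ∈ s J, φ (b.e j) * c J j := fun J => by
    simp [u, mul_comm]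
  have hu : ∀ J, 0 < ‖u J‖ := fun J => by
    rw [norm_pos_iff]
    intro h0
    have h1 := hc J
    rw [← hφu, h0] at h1
    have h2 : ‖∑ j ∈ s J, c J j • b.e j‖ = 0 := by rw [norm_eq_zero]; exact h0
    rw [h2] at h1
    simp at h1
  obtain ⟨y, hy⟩ := hX.exists_weak_limit (hyperfilter ℕ) (fun J => ‖u J‖⁻¹ • u J) 1
    (fun J => by rw [norm_smul, norm_inv, norm_norm, inv_mul_cancel₀ (hu J).ne'])
  have hy0 : y = 0 := b.eq_zero_of_coord fun j => by
    refine tendsto_nhds_unique (hy (b.coord j)) (tendsto_const_nhds.congr' ?_)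
    filter_upwards [Nat.hyperfilter_le_atTop (eventually_gt_atTop j)] with J hJ
    have : b.coord j (u J) = 0 := by
      simp only [u, map_sum, map_smul, coord_e]
      refine Finset.sum_eq_zero fun i hi => ?_
      have := hs J i hi
      rw [if_neg (by omega), smul_zero]
    rw [map_smul, this, smul_zero]
  have hlim := (hy φ).abs
  rw [hy0, map_zero, abs_zero] at hlim
  refine absurd (ge_of_tendsto' hlim fun J => ?_) (not_le.2 hδ)
  rw [map_smul, smul_eq_mul, abs_mul, abs_of_pos (inv_pos.2 (hu J)), hφu]
  rw [← div_eq_inv_mul, le_div_iff₀ (hu J)]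
  exact (hc J).le

end OneSymmetricBasis

end

section

variable {X : Type*} [NormedAddCommGroup X] [NormedSpace ℝ X] {d : ℕ}

/-- The open box with lower corner `α` and upper corner `β` (empty unless `α i < β i` for all `i`). -/
def box (α β : Fin d → ℝ) : Set (Fin d → ℝ) := Set.univ.pi fun i => Set.Ioo (α i) (β i)

lemma mem_box {α β x : Fin d → ℝ} : x ∈ box α β ↔ ∀ i, α i < x i ∧ x i < β i := by
  simp [box, Set.mem_pi]

lemma measurableSet_box (α β : Fin d → ℝ) : MeasurableSet (box α β) :=
  MeasurableSet.univ_pi fun _ => measurableSet_Ioo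

lemma box_nonempty_iff {α β : Fin d → ℝ} : (box α β).Nonempty ↔ ∀ i, α i < β i := by
  simp [box, Set.univ_pi_nonempty_iff]

lemma box_mem_parallelepipeds {Ω : Set (Fin d → ℝ)} {α β : Fin d → ℝ} (h : ∀ i, α i < β i)
    (hΩ : box α β ⊆ Ω) : box α β ∈ parallelepipeds Ω :=
  ⟨α, β, h, rfl, hΩ⟩

lemma box_subset_box {α β α' β' : Fin d → ℝ} (hα : α ≤ α') (hβ : β' ≤ β) :
    box α' β' ⊆ box α β := fun _ hx =>
  mem_box.2 fun i => ⟨(hα i).trans_lt (mem_box.1 hx i).1, (mem_box.1 hx i).2.trans_le (hβ i)⟩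

/-- The integral over a box, intersected with `Ω`. -/
def boxIntegral (Ω : Set (Fin d → ℝ)) (α β : Fin d → ℝ) :
    Lp ℝ 1 (volume.restrict Ω) →ₗ[ℝ] ℝ where
  toFun f := ∫ x in box α β, f x ∂(volume.restrict Ω)
  map_add' f g := by
    rw [← integral_add (L1.integrable_coeFn f).integrableOn (L1.integrable_coeFn g).integrableOn]
    exact integral_congr_ae (ae_restrict_of_ae (Lp.coeFn_add f g))
  map_smul' c f := by
    rw [RingHom.id_apply, smul_eq_mul, ← integral_const_mul]
    exact integral_congr_ae (ae_restrict_of_ae (Lp.coeFn_smul c f))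

variable {Ω : Set (Fin d → ℝ)}

lemma boxIntegral_apply (α β : Fin d → ℝ) (f : Lp ℝ 1 (volume.restrict Ω)) :
    boxIntegral Ω α β f = ∫ x in box α β, f x ∂(volume.restrict Ω) := rfl

lemma boxIntegral_eq_of_subset {α β : Fin d → ℝ} (h : box α β ⊆ Ω)
    (f : Lp ℝ 1 (volume.restrict Ω)) : boxIntegral Ω α β f = ∫ x in box α β, f x := by
  rw [boxIntegral_apply, Measure.restrict_restrict (measurableSet_box α β),
    Set.inter_eq_left.2 h]

lemma boxIntegral_of_empty {α β : Fin d → ℝ} (h : box α β = ∅)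
    (f : Lp ℝ 1 (volume.restrict Ω)) : boxIntegral Ω α β f = 0 := by
  simp [boxIntegral_apply, h]

lemma ae_ne_coord (i : Fin d) (c : ℝ) : ∀ᵐ x ∂(volume.restrict Ω), x i ≠ c :=
  ae_restrict_of_ae (Measure.ae_eval_ne (μ := fun _ : Fin d => (volume : Measure ℝ)) i c)

lemma continuous_boxIntegral (f : Lp ℝ 1 (volume.restrict Ω)) :
    Continuous fun p : (Fin d → ℝ) × (Fin d → ℝ) => boxIntegral Ω p.1 p.2 f := by
  rw [continuous_iff_continuousAt]
  intro p
  simp only [ContinuousAt, boxIntegral_apply, ← integral_indicator (measurableSet_box _ _)]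
  refine tendsto_integral_filter_of_dominated_convergence (fun x => ‖f x‖)
    (Eventually.of_forall fun q => ((L1.integrable_coeFn f).aestronglyMeasurable).indicator
      (measurableSet_box _ _))
    (Eventually.of_forall fun q => Eventually.of_forall fun x =>
      norm_indicator_le_norm_self _ _) (L1.integrable_coeFn f).norm ?_
  have hα : ∀ᵐ x ∂(volume.restrict Ω), ∀ i, x i ≠ p.1 i := ae_all_iff.2 fun i => ae_ne_coord i _
  have hβ : ∀ᵐ x ∂(volume.restrict Ω), ∀ i, x i ≠ p.2 i := ae_all_iff.2 fun i => ae_ne_coord i _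
  filter_upwards [hα, hβ] with x hxα hxβ
  refine tendsto_const_nhds.congr' ?_
  have h1 : ∀ᶠ q : (Fin d → ℝ) × (Fin d → ℝ) in 𝓝 p, ∀ i, (q.1 i < x i ↔ p.1 i < x i) := by
    refine eventually_all.2 fun i => ?_
    have hc : Continuous fun q : (Fin d → ℝ) × (Fin d → ℝ) => q.1 i := by fun_prop
    rcases lt_or_gt_of_ne (hxα i) with h | h
    · filter_upwards [hc.tendsto p (lt_mem_nhds h)] with q hq
      simp only [Set.mem_preimage] at hq
      exact ⟨fun h' => absurd h' hq.not_gt, fun h' => absurd h' h.not_gt⟩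
    · filter_upwards [hc.tendsto p (gt_mem_nhds h)] with q hq
      exact ⟨fun _ => h, fun _ => hq⟩
  have h2 : ∀ᶠ q : (Fin d → ℝ) × (Fin d → ℝ) in 𝓝 p, ∀ i, (x i < q.2 i ↔ x i < p.2 i) := by
    refine eventually_all.2 fun i => ?_
    have hc : Continuous fun q : (Fin d → ℝ) × (Fin d → ℝ) => q.2 i := by fun_prop
    rcases lt_or_gt_of_ne (hxβ i) with h | h
    · filter_upwards [hc.tendsto p (lt_mem_nhds h)] with q hq
      exact ⟨fun _ => h, fun _ => hq⟩
    · filter_upwards [hc.tendsto p (gt_mem_nhds h)] with q hq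
      simp only [Set.mem_preimage] at hq
      exact ⟨fun h' => absurd h' hq.not_gt, fun h' => absurd h' h.not_gt⟩
  filter_upwards [h1, h2] with q hq1 hq2
  have : x ∈ box q.1 q.2 ↔ x ∈ box p.1 p.2 := by simp [mem_box, hq1, hq2]
  by_cases hx : x ∈ box p.1 p.2
  · rw [Set.indicator_of_mem hx, Set.indicator_of_mem (this.2 hx)]
  · rw [Set.indicator_of_notMem hx, Set.indicator_of_notMem (fun h => hx (this.1 h))]

/-- Cutting a box along a hyperplane. -/
lemma boxIntegral_cut {α β : Fin d → ℝ} {i : Fin d} {c : ℝ} (hα : α i ≤ c) (hβ : c ≤ β i)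
    (f : Lp ℝ 1 (volume.restrict Ω)) :
    boxIntegral Ω α β f =
      boxIntegral Ω α (Function.update β i c) f + boxIntegral Ω (Function.update α i c) β f := by
  have hlow : ∀ x, x ∈ box α (Function.update β i c) ↔ x ∈ box α β ∧ x i < c := by
    intro x
    simp only [mem_box]
    refine ⟨fun h => ⟨fun j => ⟨(h j).1, ?_⟩, by simpa using (h i).2⟩, fun h j => ⟨(h.1 j).1, ?_⟩⟩
    · rcases eq_or_ne j i with rfl | hj
      · have := (h j).2
        rw [Function.update_self] at this
        exact this.trans_le hβ
      · simpa [hj] using (h j).2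
    · rcases eq_or_ne j i with rfl | hj
      · simpa using h.2
      · simpa [hj] using (h.1 j).2
  have hupp : ∀ x, x ∈ box (Function.update α i c) β ↔ x ∈ box α β ∧ c < x i := by
    intro x
    simp only [mem_box]
    refine ⟨fun h => ⟨fun j => ⟨?_, (h j).2⟩, by simpa using (h i).1⟩, fun h j => ⟨?_, (h.1 j).2⟩⟩
    · rcases eq_or_ne j i with rfl | hj
      · have := (h j).1
        rw [Function.update_self] at this
        exact hα.trans_lt this
      · simpa [hj] using (h j).1
    · rcases eq_or_ne j i with rfl | hj
      · simpa using h.2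
      · simpa [hj] using (h.1 j).1
  have hae : box α β =ᵐ[volume.restrict Ω]
      (box α (Function.update β i c) ∪ box (Function.update α i c) β : Set (Fin d → ℝ)) := by
    filter_upwards [ae_ne_coord (Ω := Ω) i c] with x hx
    refine propext ?_
    change x ∈ box α β ↔ x ∈ box α (Function.update β i c) ∪ box (Function.update α i c) β
    rw [Set.mem_union, hlow, hupp, ← and_or_left]
    exact ⟨fun h => ⟨h, lt_or_gt_of_ne hx⟩, fun h => h.1⟩
  rw [boxIntegral_apply, setIntegral_congr_set hae, setIntegral_union _ (measurableSet_box _ _)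
    (L1.integrable_coeFn f).integrableOn (L1.integrable_coeFn f).integrableOn]
  · rfl
  · rw [Set.disjoint_left]
    intro x h1 h2
    exact lt_asymm ((hlow x).1 h1).2 ((hupp x).1 h2).2

lemma norm_sum_boxIntegral_le (b : OneSymmetricBasis X) (f : Lp ℝ 1 (volume.restrict Ω))
    (s : Finset ℕ) (α β : ℕ → Fin d → ℝ) (hs : ∀ j ∈ s, box (α j) (β j) ∈ parallelepipeds Ω)
    (hd : (s : Set ℕ).PairwiseDisjoint fun j => box (α j) (β j)) :
    ‖∑ j ∈ s, boxIntegral Ω (α j) (β j) f • b.e j‖ ≤ jfNorm b Ω f := by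
  let ι : Fin s.card → ℕ := fun j => s.equivFin.symm j
  have hιs : ∀ j, ι j ∈ s := fun j => (s.equivFin.symm j).2
  have hι : Function.Injective ι := Subtype.val_injective.comp s.equivFin.symm.injective
  let τ : ℕ → ℕ := fun n => if h : n < s.card then ι ⟨n, h⟩ else 0
  have hτ : ∀ j : Fin s.card, τ j = ι j := fun j => by simp [τ]
  have hinj : Set.InjOn τ (Finset.range s.card) := by
    intro m hm n hn hmn
    have hm' : m < s.card := by simpa using hm
    have hn' : n < s.card := by simpa using hn
    rw [show τ m = ι ⟨m, hm'⟩ from hτ ⟨m, hm'⟩, show τ n = ι ⟨n, hn'⟩ from hτ ⟨n, hn'⟩] at hmn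
    exact congrArg Fin.val (hι hmn)
  have key : ‖∑ j ∈ s, boxIntegral Ω (α j) (β j) f • b.e j‖ =
      ‖∑ j : Fin s.card, boxIntegral Ω (α (ι j)) (β (ι j)) f • b.e j‖ := by
    have h := b.norm_sum_injOn _ τ hinj fun n => boxIntegral Ω (α (τ n)) (β (τ n)) f
    rw [Finset.sum_range, Finset.sum_range] at h
    simp only [hτ] at h
    rw [← h, ← Finset.sum_coe_sort s, ← Equiv.sum_comp s.equivFin.symm]
  rw [key]
  refine le_csSup (bddAbove_jfValues b Ω f)
    ⟨s.card, fun j => box (α (ι j)) (β (ι j)), fun j => hs _ (hιs j), fun i j hij =>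
      hd (hιs i) (hιs j) (hι.ne hij), ?_⟩
  congr 1
  refine Finset.sum_congr rfl fun j _ => ?_
  rw [boxIntegral_eq_of_subset (subset_of_mem_parallelepipeds (hs _ (hιs j)))]

/-- Functions in a ball of `JF_X(Ω)` have uniformly few large integrals over disjoint boxes. -/
lemma exists_box_card_bound (hX : IsReflexive X) (b : OneSymmetricBasis X)
    (Ω : Set (Fin d → ℝ)) {ε : ℝ} (hε : 0 < ε) (C : ℝ) :
    ∃ N : ℕ, ∀ f : Lp ℝ 1 (volume.restrict Ω), jfNorm b Ω f ≤ C → ∀ α β : ℕ → Fin d → ℝ,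
      (∀ j < N, box (α j) (β j) ∈ parallelepipeds Ω) →
      (∀ i < N, ∀ j < N, i ≠ j → Disjoint (box (α i) (β i)) (box (α j) (β j))) →
      ∃ j < N, |boxIntegral Ω (α j) (β j) f| < ε := by
  obtain ⟨N, hN⟩ := b.exists_card_bound hX hε C
  refine ⟨N, fun f hf α β hP hd => hN _ (le_trans ?_ hf)⟩
  refine norm_sum_boxIntegral_le b f _ α β (fun j hj => hP j (Finset.mem_range.1 hj)) ?_
  intro i hi j hj hij
  exact hd i (by simpa using hi) j (by simpa using hj) hij

end

section

/-- Diagonal argument: countably many properties of subsequences, each inherited by finer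
subsequences and each attainable by refining, are attained simultaneously. -/
lemma exists_strictMono_forall {ι : Type*} [Countable ι] (Q : ι → Filter ℕ → Prop)
    (hmono : ∀ i l l', l' ≤ l → Q i l → Q i l')
    (hex : ∀ i (φ : ℕ → ℕ), StrictMono φ → ∃ ψ : ℕ → ℕ, StrictMono ψ ∧ Q i (map (φ ∘ ψ) atTop)) :
    ∃ φ : ℕ → ℕ, StrictMono φ ∧ ∀ i, Q i (map φ atTop) := by
  rcases isEmpty_or_nonempty ι with hι | hι
  · exact ⟨id, strictMono_id, fun i => (hι.false i).elim⟩
  obtain ⟨f, hf⟩ := exists_surjective_nat ι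
  choose ψ hψ hQ using hex
  let Φ : ℕ → {φ : ℕ → ℕ // StrictMono φ} := fun k => Nat.rec
    ⟨ψ (f 0) id strictMono_id, hψ _ _ _⟩
    (fun k φ => ⟨φ.1 ∘ ψ (f (k + 1)) φ.1 φ.2, φ.2.comp (hψ _ _ _)⟩) k
  have hΦ : ∀ k, (Φ (k + 1)).1 = (Φ k).1 ∘ ψ (f (k + 1)) (Φ k).1 (Φ k).2 := fun k => rfl
  have hQΦ : ∀ k, Q (f k) (map (Φ k).1 atTop) := by
    intro k
    cases k with
    | zero => exact hQ (f 0) id strictMono_id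
    | succ k => rw [hΦ]; exact hQ _ _ _
  have hsub : ∀ k m j, ∃ t, j ≤ t ∧ (Φ (k + m)).1 j = (Φ k).1 t := by
    intro k m
    induction m with
    | zero => exact fun j => ⟨j, le_rfl, rfl⟩
    | succ m ih =>
      intro j
      obtain ⟨t, ht, h⟩ := ih (ψ (f (k + m + 1)) (Φ (k + m)).1 (Φ (k + m)).2 j)
      exact ⟨t, ((hψ _ _ _).id_le j).trans ht, h⟩
  refine ⟨fun n => (Φ n).1 n, strictMono_nat_of_lt_succ fun n => ?_, fun i => ?_⟩
  · rw [hΦ]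
    exact (Φ n).2 ((Nat.lt_succ_self n).trans_le ((hψ _ _ _).id_le (n + 1)))
  · obtain ⟨k, rfl⟩ := hf i
    refine hmono _ _ _ (fun S hS => ?_) (hQΦ k)
    obtain ⟨N, hN⟩ := mem_atTop_sets.1 (mem_map.1 hS)
    refine mem_map.2 (mem_atTop_sets.2 ⟨max k N, fun n hn => ?_⟩)
    obtain ⟨m, rfl⟩ := Nat.exists_eq_add_of_le (le_of_max_le_left hn)
    obtain ⟨t, ht, h⟩ := hsub k m (k + m)
    rw [Set.mem_preimage, h]
    exact hN t ((le_of_max_le_right hn).trans ht)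

variable {d : ℕ}

/-- Some box in `Ω` inside the slab of half-width `η` around `x i = c` has `v`-value at least `ε`. -/
def HasLargeThinBox (v : (Fin d → ℝ) → (Fin d → ℝ) → ℝ) (Ω : Set (Fin d → ℝ)) (ε : ℝ) (i : Fin d)
    (c η : ℝ) : Prop :=
  ∃ α β : Fin d → ℝ, (∀ j, α j < β j) ∧ box α β ⊆ Ω ∧ c - η ≤ α i ∧ β i ≤ c + η ∧ ε ≤ |v α β|

lemma HasLargeThinBox.mono {v : (Fin d → ℝ) → (Fin d → ℝ) → ℝ} {Ω : Set (Fin d → ℝ)} {ε : ℝ}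
    {i : Fin d} {c η η' : ℝ} (h : HasLargeThinBox v Ω ε i c η) (hη : η ≤ η') :
    HasLargeThinBox v Ω ε i c η' := by
  obtain ⟨α, β, h1, h2, h3, h4, h5⟩ := h
  exact ⟨α, β, h1, h2, by linarith, by linarith, h5⟩

/-- The hyperplane `x i = c` carries mass at least `ε` along the filter `l`. -/
def IsHeavy (v : ℕ → (Fin d → ℝ) → (Fin d → ℝ) → ℝ) (Ω : Set (Fin d → ℝ)) (ε : ℝ) (i : Fin d)
    (l : Filter ℕ) (c : ℝ) : Prop :=
  ∀ η > 0, ∃ᶠ n in l, HasLargeThinBox (v n) Ω ε i c η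

lemma IsHeavy.filter_mono {v : ℕ → (Fin d → ℝ) → (Fin d → ℝ) → ℝ} {Ω : Set (Fin d → ℝ)} {ε : ℝ}
    {i : Fin d} {l l' : Filter ℕ} {c : ℝ} (h : IsHeavy v Ω ε i l' c) (hl : l' ≤ l) :
    IsHeavy v Ω ε i l c :=
  fun η hη => (h η hη).filter_mono hl

/-- The uniform bound on the number of disjoint boxes with large `v`-value. -/
def BoundedLargeBoxes (v : ℕ → (Fin d → ℝ) → (Fin d → ℝ) → ℝ) (Ω : Set (Fin d → ℝ)) : Prop :=
  ∀ ε > 0, ∃ N : ℕ, ∀ n, ∀ α β : ℕ → Fin d → ℝ,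
    (∀ j < N, box (α j) (β j) ∈ parallelepipeds Ω) →
    (∀ i < N, ∀ j < N, i ≠ j → Disjoint (box (α i) (β i)) (box (α j) (β j))) →
    ∃ j < N, |v n (α j) (β j)| < ε

lemma exists_finset_strongly_heavy (v : ℕ → (Fin d → ℝ) → (Fin d → ℝ) → ℝ) (Ω : Set (Fin d → ℝ))
    (ε : ℝ) (i : Fin d) (φ : ℕ → ℕ)
    (h : ∀ ψ : ℕ → ℕ, StrictMono ψ → {c | IsHeavy v Ω ε i (map (φ ∘ ψ) atTop) c}.Infinite)
    (k : ℕ) : ∃ ψ : ℕ → ℕ, StrictMono ψ ∧ ∃ s : Finset ℝ, s.card = k ∧ ∀ c ∈ s, ∀ η > 0,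
      ∀ᶠ m in atTop, HasLargeThinBox (v (φ (ψ m))) Ω ε i c η := by
  induction k with
  | zero => exact ⟨id, strictMono_id, ∅, by simp⟩
  | succ k ih =>
    obtain ⟨ψ, hψ, s, hs, hsc⟩ := ih
    obtain ⟨c, hc, hcs⟩ := (h ψ hψ).exists_notMem_finset s
    have hfreq : ∀ m : ℕ, ∃ᶠ k in atTop,
        HasLargeThinBox (v (φ (ψ k))) Ω ε i c (1 / ((m : ℝ) + 1)) := fun m =>
      frequently_map.1 (hc _ Nat.one_div_pos_of_nat)
    obtain ⟨θ, hθ, hθP⟩ := extraction_forall_of_frequently hfreq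
    refine ⟨ψ ∘ θ, hψ.comp hθ, insert c s, by rw [Finset.card_insert_of_notMem hcs, hs], ?_⟩
    intro c' hc' η hη
    rcases Finset.mem_insert.1 hc' with rfl | hc'
    · filter_upwards [tendsto_one_div_add_atTop_nhds_zero_nat.eventually (gt_mem_nhds hη)]
        with m hm
      exact (hθP m).mono hm.le
    · exact hθ.tendsto_atTop.eventually (hsc c' hc' η hη)

lemma exists_subseq_finite_heavy {v : ℕ → (Fin d → ℝ) → (Fin d → ℝ) → ℝ} {Ω : Set (Fin d → ℝ)}
    (hv : BoundedLargeBoxes v Ω) {ε : ℝ} (hε : 0 < ε) (i : Fin d) (φ : ℕ → ℕ) :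
    ∃ ψ : ℕ → ℕ, StrictMono ψ ∧ {c | IsHeavy v Ω ε i (map (φ ∘ ψ) atTop) c}.Finite := by
  by_contra! hcon
  obtain ⟨N, hN⟩ := hv ε hε
  obtain ⟨ψ, -, s, hs, hsc⟩ := exists_finset_strongly_heavy v Ω ε i φ hcon N
  have hgap : ∀ᶠ η in 𝓝[>] (0 : ℝ), ∀ p ∈ s.offDiag, 2 * η < |p.1 - p.2| := by
    refine (Finset.eventually_all _).2 fun p hp => ?_
    have hp' : 0 < |p.1 - p.2| := abs_pos.2 (sub_ne_zero.2 (Finset.mem_offDiag.1 hp).2.2)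
    have : Tendsto (fun η : ℝ => 2 * η) (𝓝[>] 0) (𝓝 0) :=
      tendsto_nhdsWithin_of_tendsto_nhds (by simpa using (continuous_const_mul (2 : ℝ)).tendsto 0)
    exact this.eventually (gt_mem_nhds hp')
  obtain ⟨η, hgapη, hη⟩ := (hgap.and self_mem_nhdsWithin).exists
  obtain ⟨m, hm⟩ := ((Finset.eventually_all s).2 fun c hc => hsc c hc η hη).exists
  choose! α β h1 h2 h3 h4 h5 using hm
  let c : ℕ → ℝ := fun j => if h : j < N then s.orderEmbOfFin hs ⟨j, h⟩ else 0
  have hcs : ∀ j < N, c j ∈ s := fun j hj => by simp [c, hj]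
  have hinj : ∀ i < N, ∀ j < N, i ≠ j → c i ≠ c j := fun i hi j hj hij => by
    simp [c, hi, hj, hij]
  obtain ⟨j, hj, hjε⟩ := hN (φ (ψ m)) (fun j => α (c j)) (fun j => β (c j))
    (fun j hj => box_mem_parallelepipeds (h1 _ (hcs j hj)) (h2 _ (hcs j hj)))
    (fun k hk j hj hkj => by
      rw [Set.disjoint_left]
      intro x hx hx'
      have e1 := (mem_box.1 hx) i
      have e2 := (mem_box.1 hx') i
      have e3 := h3 _ (hcs k hk)
      have e4 := h4 _ (hcs k hk)
      have e5 := h3 _ (hcs j hj)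
      have e6 := h4 _ (hcs j hj)
      have e7 := hgapη (c k, c j)
        (Finset.mem_offDiag.2 ⟨hcs k hk, hcs j hj, hinj k hk j hj hkj⟩)
      refine absurd e7 (not_lt.2 (abs_le.2 ⟨?_, ?_⟩)) <;> dsimp only <;> linarith)
  exact absurd hjε (not_lt.2 (h5 _ (hcs j hj)))

/-- Additivity of a function of boxes under cutting by hyperplanes. -/
def IsCutAdditive (v : (Fin d → ℝ) → (Fin d → ℝ) → ℝ) : Prop :=
  ∀ α β i c, α i ≤ c → c ≤ β i →
    v α β = v α (Function.update β i c) + v (Function.update α i c) β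

lemma eventually_thinBox_lt {v : ℕ → (Fin d → ℝ) → (Fin d → ℝ) → ℝ} {Ω : Set (Fin d → ℝ)} {ε : ℝ}
    {i : Fin d} {l : Filter ℕ} {c : ℝ} (h : ¬ IsHeavy v Ω ε i l c) :
    ∃ η > 0, ∀ᶠ n in l, ∀ α β : Fin d → ℝ, (∀ j, α j < β j) → box α β ⊆ Ω → c - η ≤ α i →
      β i ≤ c + η → |v n α β| < ε := by
  simp only [IsHeavy, not_forall, not_frequently] at h
  obtain ⟨η, hη, h⟩ := h
  refine ⟨η, hη, h.mono fun n hn α β h1 h2 h3 h4 => ?_⟩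
  by_contra h5
  exact hn ⟨α, β, h1, h2, h3, h4, not_lt.1 h5⟩

variable {v : ℕ → (Fin d → ℝ) → (Fin d → ℝ) → ℝ} {Ω : Set (Fin d → ℝ)} {ε : ℝ} {l : Filter ℕ}
  {G : Fin d → Set ℝ}

lemma exists_left_approx (hadd : ∀ n, IsCutAdditive (v n)) (hε : 0 ≤ ε)
    (hG : ∀ i c, IsHeavy v Ω ε i l c → c ∈ G i) (hGQ : ∀ i (q : ℚ), (q : ℝ) ∈ G i)
    {α β : Fin d → ℝ} (hαβ : ∀ j, α j < β j) (hΩ : box α β ⊆ Ω) (i : Fin d) :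
    ∃ c ∈ G i, α i ≤ c ∧ c < β i ∧
      ∀ᶠ n in l, |v n α β - v n (Function.update α i c) β| ≤ ε := by
  by_cases hh : IsHeavy v Ω ε i l (α i)
  · exact ⟨α i, hG i _ hh, le_rfl, hαβ i, Eventually.of_forall fun n => by simpa using hε⟩
  · obtain ⟨η, hη, hev⟩ := eventually_thinBox_lt hh
    obtain ⟨q, hq1, hq2⟩ := exists_rat_btwn (lt_min (lt_add_of_pos_right (α i) hη) (hαβ i))
    have hq3 := hq2.trans_le (min_le_left _ _)
    have hq4 := hq2.trans_le (min_le_right _ _)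
    refine ⟨q, hGQ i q, hq1.le, hq4, hev.mono fun n hn => ?_⟩
    rw [hadd n α β i q hq1.le hq4.le, add_sub_cancel_right]
    refine (hn _ _ (fun j => ?_) ((box_subset_box le_rfl ?_).trans hΩ) (by linarith) ?_).le
    · rcases eq_or_ne j i with rfl | hj
      · simpa using hq1
      · simpa [hj] using hαβ j
    · exact update_le_iff.2 ⟨hq4.le, fun _ _ => le_rfl⟩
    · simpa using hq3.le

lemma exists_right_approx (hadd : ∀ n, IsCutAdditive (v n)) (hε : 0 ≤ ε)
    (hG : ∀ i c, IsHeavy v Ω ε i l c → c ∈ G i) (hGQ : ∀ i (q : ℚ), (q : ℝ) ∈ G i)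
    {α β : Fin d → ℝ} (hαβ : ∀ j, α j < β j) (hΩ : box α β ⊆ Ω) (i : Fin d) :
    ∃ c ∈ G i, α i < c ∧ c ≤ β i ∧
      ∀ᶠ n in l, |v n α β - v n α (Function.update β i c)| ≤ ε := by
  by_cases hh : IsHeavy v Ω ε i l (β i)
  · exact ⟨β i, hG i _ hh, hαβ i, le_rfl, Eventually.of_forall fun n => by simpa using hε⟩
  · obtain ⟨η, hη, hev⟩ := eventually_thinBox_lt hh
    obtain ⟨q, hq1, hq2⟩ := exists_rat_btwn (max_lt (sub_lt_self (β i) hη) (hαβ i))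
    have hq3 := (le_max_left _ _).trans_lt hq1
    have hq4 := (le_max_right _ _).trans_lt hq1
    refine ⟨q, hGQ i q, hq4, hq2.le, hev.mono fun n hn => ?_⟩
    rw [hadd n α β i q hq4.le hq2.le, add_sub_cancel_left]
    refine (hn _ _ (fun j => ?_) ((box_subset_box ?_ le_rfl).trans hΩ) ?_ (by linarith)).le
    · rcases eq_or_ne j i with rfl | hj
      · simpa using hq2
      · simpa [hj] using hαβ j
    · exact le_update_iff.2 ⟨hq4.le, fun _ _ => le_rfl⟩
    · simpa using hq3.le

lemma exists_grid_approx (hadd : ∀ n, IsCutAdditive (v n)) (hε : 0 ≤ ε)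
    (hG : ∀ i c, IsHeavy v Ω ε i l c → c ∈ G i) (hGQ : ∀ i (q : ℚ), (q : ℝ) ∈ G i)
    {α β : Fin d → ℝ} (hαβ : ∀ j, α j < β j) (hΩ : box α β ⊆ Ω) (s : Finset (Fin d)) :
    ∃ α' β' : Fin d → ℝ, α ≤ α' ∧ β' ≤ β ∧ (∀ j, α' j < β' j) ∧
      (∀ i ∈ s, α' i ∈ G i ∧ β' i ∈ G i) ∧
      ∀ᶠ n in l, |v n α β - v n α' β'| ≤ s.card * (2 * ε) := by
  induction s using Finset.induction_on with
  | empty => exact ⟨α, β, le_rfl, le_rfl, hαβ, by simp, Eventually.of_forall fun n => by simp⟩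
  | insert i s hi ih =>
    obtain ⟨α', β', h1, h2, h3, h4, h5⟩ := ih
    have hΩ' := (box_subset_box h1 h2).trans hΩ
    obtain ⟨c, hcG, hc1, hc2, hc⟩ := exists_left_approx hadd hε hG hGQ h3 hΩ' i
    have hα' : α' ≤ Function.update α' i c := le_update_iff.2 ⟨hc1, fun _ _ => le_rfl⟩
    have h3' : ∀ j, Function.update α' i c j < β' j := fun j => by
      rcases eq_or_ne j i with rfl | hj
      · simpa using hc2
      · simpa [hj] using h3 j
    obtain ⟨e, heG, he1, he2, he⟩ := exists_right_approx hadd hε hG hGQ h3'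
      ((box_subset_box hα' le_rfl).trans hΩ') i
    refine ⟨Function.update α' i c, Function.update β' i e, h1.trans hα',
      le_trans (update_le_iff.2 ⟨he2, fun _ _ => le_rfl⟩) h2, fun j => ?_, fun j hj => ?_,
      ?_⟩
    · rcases eq_or_ne j i with rfl | hj
      · simpa using he1
      · simpa [hj] using h3 j
    · rcases eq_or_ne j i with rfl | hji
      · simpa using ⟨hcG, heG⟩
      · simpa [hji] using h4 j (Finset.mem_of_mem_insert_of_ne hj hji)
    · filter_upwards [h5, hc, he] with n hn1 hn2 hn3
      rw [Finset.card_insert_of_notMem hi]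
      push_cast
      rw [abs_le] at *
      constructor <;> linarith [hn1.1, hn1.2, hn2.1, hn2.2, hn3.1, hn3.2]

/-- A Helly selection principle for additive functions of boxes. -/
theorem exists_subseq_cauchySeq_boxes (hv : BoundedLargeBoxes v Ω)
    (hadd : ∀ n, IsCutAdditive (v n))
    (hbdd : ∀ α β, box α β ∈ parallelepipeds Ω → ∃ C, ∀ n, |v n α β| ≤ C) :
    ∃ φ : ℕ → ℕ, StrictMono φ ∧ ∀ α β : Fin d → ℝ, (∀ j, α j < β j) → box α β ⊆ Ω →
      CauchySeq fun n => v (φ n) α β := by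
  obtain ⟨φ, hφ, hfin⟩ := exists_strictMono_forall
    (fun (p : Fin d × ℕ) l => {c | IsHeavy v Ω (1 / ((p.2 : ℝ) + 1)) p.1 l c}.Finite)
    (fun p l l' hl h => h.subset fun c hc => hc.filter_mono hl)
    (fun p φ _ => exists_subseq_finite_heavy hv Nat.one_div_pos_of_nat p.1 φ)
  let G : Fin d → Set ℝ := fun i => (⋃ k : ℕ,
    {c | IsHeavy v Ω (1 / ((k : ℝ) + 1)) i (map φ atTop) c}) ∪ Set.range ((↑) : ℚ → ℝ)
  have hGc : ∀ i, Countable (G i) := fun i => Set.countable_coe_iff.2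
    ((Set.countable_iUnion fun k => (hfin (i, k)).countable).union (Set.countable_range _))
  obtain ⟨ψ, hψ, hconv⟩ := exists_strictMono_forall
    (fun (p : (∀ i, G i) × (∀ i, G i)) l =>
      box (fun i => (p.1 i : ℝ)) (fun i => (p.2 i : ℝ)) ∈ parallelepipeds Ω →
        ∃ L, Tendsto (fun n => v (φ n) (fun i => p.1 i) (fun i => p.2 i)) l (𝓝 L))
    (fun p l l' hl h hp => (h hp).imp fun L hL => hL.mono_left hl)
    (fun p χ _ => by
      by_cases hp : box (fun i => (p.1 i : ℝ)) (fun i => (p.2 i : ℝ)) ∈ parallelepipeds Ω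
      · obtain ⟨C, hC⟩ := hbdd _ _ hp
        obtain ⟨L, -, ψ, hψ, hL⟩ := tendsto_subseq_of_bounded
          (x := fun n => v (φ (χ n)) (fun i => p.1 i) (fun i => p.2 i))
          (Metric.isBounded_closedBall (x := (0 : ℝ)) (r := C)) (fun n => by simpa using hC _)
        exact ⟨ψ, hψ, fun _ => ⟨L, tendsto_map'_iff.2 hL⟩⟩
      · exact ⟨id, strictMono_id, fun h => absurd h hp⟩)
  refine ⟨φ ∘ ψ, hφ.comp hψ, fun α β hαβ hΩ => ?_⟩
  rw [Metric.cauchySeq_iff]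
  intro ε hε
  obtain ⟨k, hk⟩ := exists_nat_one_div_lt (show 0 < ε / (4 * d + 2) by positivity)
  have hle : map (φ ∘ ψ) atTop ≤ map φ atTop := by
    rw [← map_map]
    exact map_mono hψ.tendsto_atTop
  obtain ⟨α', β', h1, h2, h3, h4, h5⟩ := exists_grid_approx (G := G) (l := map (φ ∘ ψ) atTop)
    hadd Nat.one_div_pos_of_nat.le
    (fun i c hc => Or.inl (Set.mem_iUnion.2 ⟨k, hc.filter_mono hle⟩))
    (fun i q => Or.inr ⟨q, rfl⟩) hαβ hΩ Finset.univ
  obtain ⟨L, hL⟩ := hconv (fun i => ⟨α' i, (h4 i (Finset.mem_univ i)).1⟩,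
    fun i => ⟨β' i, (h4 i (Finset.mem_univ i)).2⟩)
    (box_mem_parallelepipeds h3 ((box_subset_box h1 h2).trans hΩ))
  have hL' := Metric.tendsto_nhds.1 (tendsto_map'_iff.1 hL) _
    (show 0 < ε / (4 * d + 2) by positivity)
  obtain ⟨N, hN⟩ := eventually_atTop.1 ((eventually_map.1 h5).and hL')
  have hkey : ∀ n ≥ N, |v ((φ ∘ ψ) n) α β - L| < (2 * d + 1) * (ε / (4 * d + 2)) := by
    intro n hn
    obtain ⟨e1, e2⟩ := hN n hn
    rw [Finset.card_univ, Fintype.card_fin] at e1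
    have e3 : |v ((φ ∘ ψ) n) α' β' - L| < ε / (4 * d + 2) := e2
    have e4 : (d : ℝ) * (2 * (1 / ((k : ℝ) + 1))) ≤ d * (2 * (ε / (4 * d + 2))) := by gcongr
    have := abs_sub_le (v ((φ ∘ ψ) n) α β) (v ((φ ∘ ψ) n) α' β') L
    linarith
  refine ⟨N, fun m hm n hn => ?_⟩
  rw [Real.dist_eq]
  have e1 := hkey m hm
  have e2 := hkey n hn
  rw [abs_sub_comm] at e2
  have e3 := abs_sub_le (v ((φ ∘ ψ) m) α β) L (v ((φ ∘ ψ) n) α β)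
  have e4 : (2 * d + 1) * (ε / (4 * d + 2)) = ε / 2 := by
    field_simp; ring
  linarith

end

section

variable {X : Type*} [NormedAddCommGroup X] [NormedSpace ℝ X] {d : ℕ}

/-- The parameters of a functional `f ↦ ∑ j, a (e j) * ∫_{T j} f`: the coefficient functional `a`
and the lower and upper corners of the boxes `T j`. -/
abbrev Params (X : Type*) [NormedAddCommGroup X] [NormedSpace ℝ X] (d : ℕ) : Type _ :=
  WeakDual ℝ X × (ℕ → Fin d → ℝ) × (ℕ → Fin d → ℝ)

/-- A compact set of parameters: the coefficients are nonincreasing in absolute value, and the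
boxes with nonzero coefficient are disjoint and contained in `Ω`. -/
structure IsNormingParam (b : OneSymmetricBasis X) (Ω : Set (Fin d → ℝ)) (R : ℝ)
    (p : Params X d) : Prop where
  norm_le : p.1 ∈ WeakDual.toStrongDual ⁻¹' Metric.closedBall 0 1
  lower_le : ∀ j, p.2.1 j ∈ Metric.closedBall 0 R
  upper_le : ∀ j, p.2.2 j ∈ Metric.closedBall 0 R
  antitone : ∀ i j, i ≤ j → |p.1 (b.e j)| ≤ |p.1 (b.e i)|
  subset : ∀ j, ∀ x ∉ Ω, p.1 (b.e j) = 0 ∨ x ∉ box (p.2.1 j) (p.2.2 j)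
  disjoint : ∀ i j, i ≠ j → ∀ x, p.1 (b.e i) = 0 ∨ p.1 (b.e j) = 0 ∨
    x ∉ box (p.2.1 i) (p.2.2 i) ∨ x ∉ box (p.2.1 j) (p.2.2 j)

lemma continuous_coeff (x : X) : Continuous fun p : Params X d => p.1 x :=
  (WeakDual.eval_continuous x).comp continuous_fst

lemma isClosed_notMem_box (j : ℕ) (x : Fin d → ℝ) :
    IsClosed {p : Params X d | x ∉ box (p.2.1 j) (p.2.2 j)} := by
  have : {p : Params X d | x ∉ box (p.2.1 j) (p.2.2 j)} =
      ⋃ i, ({p : Params X d | x i ≤ p.2.1 j i} ∪ {p : Params X d | p.2.2 j i ≤ x i}) := by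
    ext p
    simp [mem_box, or_iff_not_imp_left]
  rw [this]
  exact isClosed_iUnion_of_finite fun i =>
    (isClosed_le (by fun_prop) (by fun_prop)).union (isClosed_le (by fun_prop) (by fun_prop))

lemma isCompact_setOf_isNormingParam (b : OneSymmetricBasis X) (Ω : Set (Fin d → ℝ)) (R : ℝ) :
    IsCompact {p : Params X d | IsNormingParam b Ω R p} := by
  have hprod : IsCompact ((WeakDual.toStrongDual ⁻¹' Metric.closedBall (0 : StrongDual ℝ X) 1) ×ˢ
      ((Set.univ.pi fun _ : ℕ => Metric.closedBall (0 : Fin d → ℝ) R) ×ˢ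
        (Set.univ.pi fun _ : ℕ => Metric.closedBall (0 : Fin d → ℝ) R))) :=
    (WeakDual.isCompact_closedBall 0 1).prod
      ((isCompact_univ_pi fun _ => isCompact_closedBall _ _).prod
        (isCompact_univ_pi fun _ => isCompact_closedBall _ _))
  have h0 : ∀ j, IsClosed {p : Params X d | p.1 (b.e j) = 0} := fun j =>
    isClosed_eq (continuous_coeff _) continuous_const
  have hclosed : IsClosed ({p : Params X d | ∀ i j, i ≤ j → |p.1 (b.e j)| ≤ |p.1 (b.e i)|} ∩
      ({p : Params X d | ∀ j, ∀ x ∉ Ω, p.1 (b.e j) = 0 ∨ x ∉ box (p.2.1 j) (p.2.2 j)} ∩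
        {p : Params X d | ∀ i j, i ≠ j → ∀ x, p.1 (b.e i) = 0 ∨ p.1 (b.e j) = 0 ∨
          x ∉ box (p.2.1 i) (p.2.2 i) ∨ x ∉ box (p.2.1 j) (p.2.2 j)})) := by
    refine IsClosed.inter ?_ (IsClosed.inter ?_ ?_)
    · simp only [Set.ofPred_forall]
      exact isClosed_iInter fun i => isClosed_iInter fun j => isClosed_iInter fun _ =>
        isClosed_le (continuous_coeff _).abs (continuous_coeff _).abs
    · simp only [Set.ofPred_forall]
      exact isClosed_iInter fun j => isClosed_iInter fun x => isClosed_iInter fun _ =>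
        (h0 j).union (isClosed_notMem_box j x)
    · simp only [Set.ofPred_forall]
      exact isClosed_iInter fun i => isClosed_iInter fun j => isClosed_iInter fun _ =>
        isClosed_iInter fun x => (h0 i).union ((h0 j).union
          ((isClosed_notMem_box i x).union (isClosed_notMem_box j x)))
  convert! hprod.inter_right hclosed using 1
  ext p
  refine ⟨fun h => ⟨⟨h.norm_le, fun j _ => h.lower_le j, fun j _ => h.upper_le j⟩, h.antitone,
    h.subset, h.disjoint⟩, fun h => ⟨h.1.1, fun j => h.1.2.1 j trivial, fun j => h.1.2.2 j trivial,
    h.2.1, h.2.2.1, h.2.2.2⟩⟩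

variable {b : OneSymmetricBasis X} {Ω : Set (Fin d → ℝ)} {R : ℝ} {p : Params X d}

/-- One term of the functional with parameters `p`. -/
def paramTerm (b : OneSymmetricBasis X) (Ω : Set (Fin d → ℝ)) (p : Params X d)
    (f : Lp ℝ 1 (volume.restrict Ω)) (j : ℕ) : ℝ :=
  p.1 (b.e j) * boxIntegral Ω (p.2.1 j) (p.2.2 j) f

/-- The functional with parameters `p`. -/
def paramEval (b : OneSymmetricBasis X) (Ω : Set (Fin d → ℝ)) (p : Params X d)
    (f : Lp ℝ 1 (volume.restrict Ω)) : ℝ :=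
  ∑' j, paramTerm b Ω p f j

lemma IsNormingParam.pairwiseDisjoint (hp : IsNormingParam b Ω R p) {s : Set ℕ}
    (hs : ∀ j ∈ s, p.1 (b.e j) ≠ 0) :
    s.PairwiseDisjoint fun j => box (p.2.1 j) (p.2.2 j) := by
  intro i hi j hj hij
  refine Set.disjoint_left.2 fun x hxi hxj => ?_
  rcases hp.disjoint i j hij x with h | h | h | h
  exacts [hs i hi h, hs j hj h, h hxi, h hxj]

lemma IsNormingParam.box_subset (hp : IsNormingParam b Ω R p) {j : ℕ} (hj : p.1 (b.e j) ≠ 0) :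
    box (p.2.1 j) (p.2.2 j) ⊆ Ω := by
  intro x hx
  by_contra hxΩ
  rcases hp.subset j x hxΩ with h | h
  exacts [hj h, h hx]

lemma IsNormingParam.abs_apply_le (hp : IsNormingParam b Ω R p) (x : X) : |p.1 x| ≤ ‖x‖ := by
  have h : ‖WeakDual.toStrongDual p.1‖ ≤ 1 := by simpa using hp.norm_le
  have := (WeakDual.toStrongDual p.1).le_of_opNorm_le h x
  rwa [one_mul] at this

lemma IsNormingParam.sum_abs_le (hp : IsNormingParam b Ω R p) (f : Lp ℝ 1 (volume.restrict Ω))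
    (s : Finset ℕ) {ε : ℝ} (hε : 0 ≤ ε) (hs : ∀ j ∈ s, |p.1 (b.e j)| ≤ ε) :
    ∑ j ∈ s, |paramTerm b Ω p f j| ≤ ε * ∫ x in Ω, ‖f x‖ := by
  have hf : Integrable (fun x => ‖f x‖) (volume.restrict Ω) := (L1.integrable_coeFn f).norm
  calc ∑ j ∈ s, |paramTerm b Ω p f j|
      = ∑ j ∈ s with p.1 (b.e j) ≠ 0, |paramTerm b Ω p f j| := by
        refine (Finset.sum_filter_of_ne fun j _ hj => ?_).symm
        contrapose! hj
        simp [paramTerm, hj]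
    _ ≤ ∑ j ∈ s with p.1 (b.e j) ≠ 0,
          ε * ∫ x in box (p.2.1 j) (p.2.2 j), ‖f x‖ ∂(volume.restrict Ω) := by
        refine Finset.sum_le_sum fun j hj => ?_
        rw [paramTerm, abs_mul]
        exact mul_le_mul (hs j (Finset.mem_filter.1 hj).1)
          (norm_integral_le_integral_norm (fun x => f x)) (abs_nonneg _) hε
    _ = ε * ∫ x in ⋃ j ∈ ({j ∈ s | p.1 (b.e j) ≠ 0} : Finset ℕ), box (p.2.1 j) (p.2.2 j),
          ‖f x‖ ∂(volume.restrict Ω) := by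
        rw [← Finset.mul_sum, integral_biUnion_finset _ (fun j _ => measurableSet_box _ _)
          (hp.pairwiseDisjoint fun j hj => (Finset.mem_filter.1 hj).2)
          (fun j _ => hf.integrableOn)]
    _ ≤ ε * ∫ x in Ω, ‖f x‖ := by
        exact mul_le_mul_of_nonneg_left
          (setIntegral_le_integral hf (Eventually.of_forall fun x => norm_nonneg _)) hε

lemma IsNormingParam.summable (hp : IsNormingParam b Ω R p) (f : Lp ℝ 1 (volume.restrict Ω)) :
    Summable (paramTerm b Ω p f) := by
  refine Summable.of_norm (summable_of_sum_le (c := ‖b.e 0‖ * ∫ x in Ω, ‖f x‖)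
    (fun j => norm_nonneg _) fun s => ?_)
  exact hp.sum_abs_le f s (norm_nonneg _) fun j _ => (hp.abs_apply_le _).trans (b.norm_e j).le

lemma IsNormingParam.tendsto_partialSum (hp : IsNormingParam b Ω R p)
    (f : Lp ℝ 1 (volume.restrict Ω)) :
    Tendsto (fun n => ∑ j ∈ Finset.range n, paramTerm b Ω p f j) atTop
      (𝓝 (paramEval b Ω p f)) :=
  (hp.summable f).hasSum.tendsto_sum_nat

lemma IsNormingParam.abs_paramEval_sub_le (hp : IsNormingParam b Ω R p)
    (f : Lp ℝ 1 (volume.restrict Ω)) {N : ℕ} {D : ℝ}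
    (h : ∀ s : Finset ℕ, (∀ j ∈ s, N ≤ j) → |∑ j ∈ s, paramTerm b Ω p f j| ≤ D) :
    |paramEval b Ω p f - ∑ j ∈ Finset.range N, paramTerm b Ω p f j| ≤ D := by
  refine le_of_tendsto ((hp.tendsto_partialSum f).sub_const _).abs ?_
  filter_upwards [eventually_ge_atTop N] with n hn
  rw [← Finset.sum_Ico_eq_sub _ hn]
  exact h _ fun j hj => (Finset.mem_Ico.1 hj).1

lemma IsNormingParam.paramEval_sum (hp : IsNormingParam b Ω R p) {ι : Type*} [Fintype ι]
    (w : ι → ℝ) (f : ι → Lp ℝ 1 (volume.restrict Ω)) :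
    paramEval b Ω p (∑ i, w i • f i) = ∑ i, w i * paramEval b Ω p (f i) := by
  have h := hasSum_sum (s := Finset.univ)
    fun i _ => ((hp.summable (f i)).hasSum.mul_left (w i))
  refine Eq.trans ?_ h.tsum_eq
  rw [paramEval]
  congr 1
  funext j
  simp only [paramTerm, map_sum, map_smul, smul_eq_mul, Finset.mul_sum]
  exact Finset.sum_congr rfl fun i _ => by ring

/-- The terms can be restricted to the genuine parallelepipeds. -/
lemma IsNormingParam.exists_subset_sum_eq (hp : IsNormingParam b Ω R p) (s : Finset ℕ) :
    ∃ t ⊆ s, (∀ j ∈ t, box (p.2.1 j) (p.2.2 j) ∈ parallelepipeds Ω) ∧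
      ((t : Set ℕ).PairwiseDisjoint fun j => box (p.2.1 j) (p.2.2 j)) ∧
      ∀ f, ∑ j ∈ s, paramTerm b Ω p f j = ∑ j ∈ t, paramTerm b Ω p f j := by
  classical
  refine ⟨{j ∈ s | p.1 (b.e j) ≠ 0 ∧ (box (p.2.1 j) (p.2.2 j)).Nonempty},
    Finset.filter_subset _ _, fun j hj => ?_, hp.pairwiseDisjoint fun j hj => ?_, fun f => ?_⟩
  · have hj' := (Finset.mem_filter.1 hj).2
    exact box_mem_parallelepipeds (box_nonempty_iff.1 hj'.2) (hp.box_subset hj'.1)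
  · exact (Finset.mem_filter.1 hj).2.1
  · refine (Finset.sum_filter_of_ne fun j _ hj => ⟨fun h0 => hj (by simp [paramTerm, h0]), ?_⟩).symm
    by_contra hne
    exact hj (by rw [paramTerm, boxIntegral_of_empty (Set.not_nonempty_iff_eq_empty.1 hne), mul_zero])

lemma IsNormingParam.abs_paramEval_le (hp : IsNormingParam b Ω R p)
    (f : Lp ℝ 1 (volume.restrict Ω)) : |paramEval b Ω p f| ≤ jfNorm b Ω f := by
  refine le_of_tendsto (hp.tendsto_partialSum f).abs (Eventually.of_forall fun n => ?_)
  obtain ⟨t, -, ht, htd, hsum⟩ := hp.exists_subset_sum_eq (Finset.range n)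
  rw [hsum]
  have : ∑ j ∈ t, paramTerm b Ω p f j =
      p.1 (∑ j ∈ t, boxIntegral Ω (p.2.1 j) (p.2.2 j) f • b.e j) := by
    simp [paramTerm, mul_comm]
  rw [this]
  exact (hp.abs_apply_le _).trans (norm_sum_boxIntegral_le b f t _ _ ht htd)

lemma continuous_paramTerm (f : Lp ℝ 1 (volume.restrict Ω)) (j : ℕ) :
    Continuous fun p : Params X d => paramTerm b Ω p f j := by
  refine (continuous_coeff _).mul ?_
  have h : Continuous fun p : Params X d => (p.2.1 j, p.2.2 j) := by fun_prop
  exact (continuous_boxIntegral f).comp h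

lemma continuous_paramEval (hX : IsReflexive X) (f : Lp ℝ 1 (volume.restrict Ω)) :
    Continuous fun p : {p : Params X d // IsNormingParam b Ω R p} => paramEval b Ω p.1 f := by
  have hlim : TendstoUniformly
      (fun n (p : {p : Params X d // IsNormingParam b Ω R p}) =>
        ∑ j ∈ Finset.range n, paramTerm b Ω p.1 f j) (fun p => paramEval b Ω p.1 f) atTop := by
    rw [Metric.tendstoUniformly_iff]
    intro ε hε
    have hI : 0 ≤ ∫ x in Ω, ‖f x‖ := integral_nonneg fun x => norm_nonneg _
    obtain ⟨N, hN⟩ := b.exists_dual_card_bound hX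
      (show 0 < ε / ((∫ x in Ω, ‖f x‖) + 1) by positivity)
    filter_upwards [eventually_ge_atTop N] with n hn p
    obtain ⟨k, hk, hkε⟩ := hN (WeakDual.toStrongDual p.1.1) (by simpa using p.2.norm_le)
    rw [Real.dist_eq]
    refine (p.2.abs_paramEval_sub_le f (D := ε / ((∫ x in Ω, ‖f x‖) + 1) * ∫ x in Ω, ‖f x‖)
      fun s hs => ?_).trans_lt ?_
    · refine (Finset.abs_sum_le_sum_abs _ _).trans
        (p.2.sum_abs_le f s (by positivity) fun j hj => ?_)
      exact (p.2.antitone k j ((hk.le.trans hn).trans (hs j hj))).trans hkε.le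
    · rw [div_mul_eq_mul_div, div_lt_iff₀ (by positivity)]
      exact mul_lt_mul_of_pos_left (lt_add_one _) hε
  exact hlim.continuous (Eventually.of_forall fun n => continuous_finsetSum _ fun j _ =>
    (continuous_paramTerm f j).comp continuous_subtype_val).frequently

/-- Boundedness and convergence to zero on boxes give pointwise convergence to zero. -/
lemma IsNormingParam.tendsto_paramEval (hp : IsNormingParam b Ω R p) (hX : IsReflexive X)
    (f : ℕ → Lp ℝ 1 (volume.restrict Ω)) (C : ℝ) (hC : ∀ n, jfNorm b Ω (f n) ≤ C)
    (hf : ∀ α β : Fin d → ℝ, (∀ j, α j < β j) → box α β ⊆ Ω →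
      Tendsto (fun n => boxIntegral Ω α β (f n)) atTop (𝓝 0)) :
    Tendsto (fun n => paramEval b Ω p (f n)) atTop (𝓝 0) := by
  have hC0 : 0 ≤ C := (jfNorm_nonneg b Ω (f 0)).trans (hC 0)
  rw [Metric.tendsto_nhds]
  intro ε hε
  have hδ : 0 < ε / (2 * (C + 1)) := by positivity
  obtain ⟨J, hJ⟩ := b.exists_tail_le hX (WeakDual.toStrongDual p.1) hδ
  have hterm : ∀ j, Tendsto (fun n => paramTerm b Ω p (f n) j) atTop (𝓝 0) := by
    intro j
    by_cases h0 : p.1 (b.e j) = 0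
    · simp [paramTerm, h0]
    by_cases hne : (box (p.2.1 j) (p.2.2 j)).Nonempty
    · simpa [paramTerm] using
        (hf _ _ (box_nonempty_iff.1 hne) (hp.box_subset h0)).const_mul (p.1 (b.e j))
    · simp [paramTerm, boxIntegral_of_empty (Set.not_nonempty_iff_eq_empty.1 hne)]
  have hhead : Tendsto (fun n => ∑ j ∈ Finset.range J, paramTerm b Ω p (f n) j) atTop (𝓝 0) := by
    simpa using tendsto_finsetSum (Finset.range J) fun j _ => hterm j
  filter_upwards [Metric.tendsto_nhds.1 hhead (ε / 2) (by positivity)] with n hn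
  have htail : |paramEval b Ω p (f n) - ∑ j ∈ Finset.range J, paramTerm b Ω p (f n) j| ≤
      ε / (2 * (C + 1)) * C := by
    refine hp.abs_paramEval_sub_le _ fun s hs => ?_
    obtain ⟨t, hts, ht, htd, hsum⟩ := hp.exists_subset_sum_eq s
    rw [hsum]
    refine (hJ t (fun j hj => hs j (hts hj)) _).trans ?_
    gcongr
    exact (norm_sum_boxIntegral_le b (f n) t _ _ ht htd).trans (hC n)
  have h2 : ε / (2 * (C + 1)) * C ≤ ε / 2 := by
    rw [div_mul_eq_mul_div, div_le_div_iff₀ (by positivity) (by positivity)]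
    nlinarith
  rw [Real.dist_eq, sub_zero] at hn ⊢
  have h3 := abs_sub_abs_le_abs_sub (paramEval b Ω p (f n))
    (∑ j ∈ Finset.range J, paramTerm b Ω p (f n) j)
  linarith

lemma corner_mem_closedBall {α β : Fin d → ℝ} (h : ∀ j, α j < β j)
    (hR : box α β ⊆ Metric.closedBall 0 R) :
    α ∈ Metric.closedBall 0 R ∧ β ∈ Metric.closedBall 0 R := by
  have hcl : closure (box α β) = Set.univ.pi fun i => Set.Icc (α i) (β i) := by
    rw [box, closure_pi_set]
    simp only [closure_Ioo (h _).ne]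
  have hsub := closure_minimal hR Metric.isClosed_closedBall
  rw [hcl] at hsub
  exact ⟨hsub fun i _ => Set.left_mem_Icc.2 (h i).le, hsub fun i _ => Set.right_mem_Icc.2 (h i).le⟩

/-- The functionals with norming parameters compute the norm. -/
lemma exists_isNormingParam_eq (hR0 : 0 ≤ R) (hR : Ω ⊆ Metric.closedBall 0 R)
    (f : Lp ℝ 1 (volume.restrict Ω)) {r : ℝ} (hr : r ∈ jfValues b Ω f) :
    ∃ p : Params X d, IsNormingParam b Ω R p ∧ paramEval b Ω p f = r := by
  obtain ⟨m, T, hT, hd, rfl⟩ := hr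
  choose α β hαβ hTeq hTΩ using hT
  have hbox : ∀ j, T j = box (α j) (β j) := hTeq
  obtain ⟨φ, hφ1, hφ⟩ := exists_dual_vector'' ℝ (∑ j, (∫ x in T j, f x) • b.e j)
  let σ : Equiv.Perm (Fin m) := Tuple.sort fun j => -|φ (b.e j)|
  have hσ : ∀ i j, i ≤ j → |φ (b.e (σ j))| ≤ |φ (b.e (σ i))| := fun i j hij =>
    neg_le_neg_iff.1 (Tuple.monotone_sort (fun j : Fin m => -|φ (b.e j)|) hij)
  obtain ⟨π, hπ⟩ := (Finset.range m).exists_perm_extending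
    (fun n => if h : n < m then (σ ⟨n, h⟩ : ℕ) else n) (by
      intro i hi j hj hij
      have hi' : i < m := by simpa using hi
      have hj' : j < m := by simpa using hj
      simp only [hi', hj', dif_pos] at hij
      simpa using σ.injective (Fin.ext hij))
  have hπσ : ∀ j : Fin m, π j = σ j := fun j => by rw [hπ j (by simp)]; simp
  let a : StrongDual ℝ X := φ.comp (b.signPerm (Finset.range m) (fun _ => 1) π)
  have ha1 : ‖a‖ ≤ 1 := (ContinuousLinearMap.opNorm_comp_le _ _).trans
    (mul_le_one₀ hφ1 (norm_nonneg _) (b.norm_signPerm_le _ _ (by simp) π))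
  have ha : ∀ j : Fin m, a (b.e j) = φ (b.e (σ j)) := fun j => by
    simp [a, b.signPerm_e_of_mem (Finset.mem_range.2 j.2), hπσ]
  have ha0 : ∀ j, m ≤ j → a (b.e j) = 0 := fun j hj => by
    simp [a, b.signPerm_e_of_notMem (show j ∉ Finset.range m by simpa using hj)]
  let α' : ℕ → Fin d → ℝ := fun n => if h : n < m then α (σ ⟨n, h⟩) else 0
  let β' : ℕ → Fin d → ℝ := fun n => if h : n < m then β (σ ⟨n, h⟩) else 0
  have hbox' : ∀ j : Fin m, box (α' j) (β' j) = T (σ j) := fun j => by simp [α', β', hbox]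
  have hcorner : ∀ j, α j ∈ Metric.closedBall 0 R ∧ β j ∈ Metric.closedBall 0 R := fun j =>
    corner_mem_closedBall (hαβ j) ((hbox j ▸ hTΩ j).trans hR)
  have hp : IsNormingParam b Ω R (StrongDual.toWeakDual a, α', β') :=
    { norm_le := by simpa using ha1
      lower_le := fun j => by
        by_cases h : j < m
        · simpa [α', h] using (hcorner (σ ⟨j, h⟩)).1
        · simpa [α', h] using hR0
      upper_le := fun j => by
        by_cases h : j < m
        · simpa [β', h] using (hcorner (σ ⟨j, h⟩)).2
        · simpa [β', h] using hR0
      antitone := fun i j hij => by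
        change |a (b.e j)| ≤ |a (b.e i)|
        by_cases h : j < m
        · rw [ha ⟨j, h⟩, ha ⟨i, hij.trans_lt h⟩]
          exact hσ _ _ hij
        · rw [ha0 j (not_lt.1 h), abs_zero]
          exact abs_nonneg _
      subset := fun j x hx => by
        by_cases h : j < m
        · refine Or.inr fun hxj => hx (hTΩ (σ ⟨j, h⟩) ?_)
          rw [← hbox' ⟨j, h⟩]
          exact hxj
        · exact Or.inl (ha0 j (not_lt.1 h))
      disjoint := fun i j hij x => by
        by_cases hi : i < m
        · by_cases hj : j < m
          · by_contra! hcon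
            have h1 : x ∈ T (σ ⟨i, hi⟩) := by rw [← hbox' ⟨i, hi⟩]; exact hcon.2.2.1
            have h2 : x ∈ T (σ ⟨j, hj⟩) := by rw [← hbox' ⟨j, hj⟩]; exact hcon.2.2.2
            refine Set.disjoint_left.1 (hd (σ.injective.ne ?_)) h1 h2
            simpa using hij
          · exact Or.inr (Or.inl (ha0 j (not_lt.1 hj)))
        · exact Or.inl (ha0 i (not_lt.1 hi)) }
  refine ⟨_, hp, ?_⟩
  rw [paramEval, tsum_eq_sum (s := Finset.range m) fun j hj => ?_, Finset.sum_range]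
  · rw [← show φ (∑ j, (∫ x in T j, f x) • b.e j) = ‖∑ j, (∫ x in T j, f x) • b.e j‖ from hφ,
      map_sum, ← Equiv.sum_comp σ fun j => φ ((∫ x in T j, f x) • b.e j)]
    refine Finset.sum_congr rfl fun j _ => ?_
    have h1 : boxIntegral Ω (α' j) (β' j) f = ∫ x in T (σ j), f x := by
      rw [boxIntegral_eq_of_subset (by rw [hbox']; exact hTΩ _), hbox']
    rw [map_smul, smul_eq_mul, ← h1, ← ha, mul_comm]
    rfl
  · change a (b.e j) * _ = 0
    rw [ha0 j (by simpa using hj), zero_mul]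

end

section

variable {X : Type*} [NormedAddCommGroup X] [NormedSpace ℝ X] {d : ℕ}

lemma abs_boxIntegral_mul_norm_le (b : OneSymmetricBasis X) {Ω : Set (Fin d → ℝ)}
    {α β : Fin d → ℝ} (h : box α β ∈ parallelepipeds Ω) (f : Lp ℝ 1 (volume.restrict Ω)) :
    |boxIntegral Ω α β f| * ‖b.e 0‖ ≤ jfNorm b Ω f := by
  have := norm_sum_boxIntegral_le b f {0} (fun _ => α) (fun _ => β) (fun _ _ => h) (by simp)
  simpa [norm_smul] using this

/-- Every sequence bounded in `JF_X(Ω)` has a subsequence converging on all boxes. -/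
lemma exists_subseq_cauchySeq_boxIntegral (hX : IsReflexive X) (b : OneSymmetricBasis X)
    (Ω : Set (Fin d → ℝ)) (f : ℕ → Lp ℝ 1 (volume.restrict Ω)) (C : ℝ)
    (hC : ∀ n, jfNorm b Ω (f n) ≤ C) :
    ∃ φ : ℕ → ℕ, StrictMono φ ∧ ∀ α β : Fin d → ℝ, (∀ j, α j < β j) → box α β ⊆ Ω →
      CauchySeq fun n => boxIntegral Ω α β (f (φ n)) := by
  refine exists_subseq_cauchySeq_boxes (v := fun n α β => boxIntegral Ω α β (f n)) ?_ ?_ ?_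
  · intro ε hε
    obtain ⟨N, hN⟩ := exists_box_card_bound hX b Ω hε C
    exact ⟨N, fun n => hN (f n) (hC n)⟩
  · exact fun n α β i c h1 h2 => boxIntegral_cut h1 h2 (f n)
  · refine fun α β h => ⟨C / ‖b.e 0‖, fun n => ?_⟩
    rw [le_div_iff₀ (norm_pos_iff.2 (b.e_ne_zero 0))]
    exact (abs_boxIntegral_mul_norm_le b h (f n)).trans (hC n)

/-- A sequence bounded in `JF_X(Ω)` has differences of two disjoint subsequences with convex
combinations of small norm. -/
lemma exists_convexCombination_sub_le (hX : IsReflexive X) (b : OneSymmetricBasis X)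
    {Ω : Set (Fin d → ℝ)} (hΩ : Bornology.IsBounded Ω) (f : ℕ → Lp ℝ 1 (volume.restrict Ω))
    (C : ℝ) (hC : ∀ n, jfNorm b Ω (f n) ≤ C) {ε : ℝ} (hε : 0 < ε) :
    ∃ (A : Set ℕ) (ι : Type) (_ : Fintype ι) (w : ι → ℝ) (n n' : ι → ℕ), (∀ i, 0 ≤ w i) ∧
      ∑ i, w i = 1 ∧ (∀ i, n i ∈ A) ∧ (∀ i, n' i ∉ A) ∧
      jfNorm b Ω (∑ i, w i • (f (n i) - f (n' i))) ≤ ε := by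
  obtain ⟨φ, hφ, hcau⟩ := exists_subseq_cauchySeq_boxIntegral hX b Ω f C hC
  obtain ⟨R, hR0, hR⟩ := hΩ.subset_closedBall_lt 0 0
  let g : ℕ → Lp ℝ 1 (volume.restrict Ω) := fun n => f (φ (2 * n + 1)) - f (φ (2 * n))
  have hgC : ∀ n, jfNorm b Ω (g n) ≤ C + C := fun n => by
    have h1 := jfNorm_add_le b Ω (f (φ (2 * n + 1))) ((-1 : ℝ) • f (φ (2 * n)))
    have h2 := jfNorm_smul_le b Ω (-1) (f (φ (2 * n)))
    rw [neg_one_smul, ← sub_eq_add_neg] at h1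
    rw [neg_one_smul, norm_neg, norm_one, one_mul] at h2
    exact h1.trans (add_le_add (hC _) (h2.trans (hC _)))
  have hg0 : ∀ α β : Fin d → ℝ, (∀ j, α j < β j) → box α β ⊆ Ω →
      Tendsto (fun n => boxIntegral Ω α β (g n)) atTop (𝓝 0) := by
    intro α β h1 h2
    obtain ⟨L, hL⟩ := cauchySeq_tendsto_of_complete (hcau α β h1 h2)
    have ht : Tendsto (fun n : ℕ => 2 * n) atTop atTop :=
      tendsto_id.const_mul_atTop' two_pos
    have := (hL.comp ((tendsto_add_atTop_nat 1).comp ht)).sub (hL.comp ht)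
    simpa [g, Function.comp_def] using this
  have : CompactSpace {p : Params X d // IsNormingParam b Ω R p} :=
    isCompact_iff_compactSpace.1 (isCompact_setOf_isNormingParam b Ω R)
  obtain ⟨ι, hι, w, n, hw, hw1, hlt⟩ := exists_convexCombination_abs_lt
    (fun n => (⟨_, continuous_paramEval hX (g n)⟩ :
      C({p : Params X d // IsNormingParam b Ω R p}, ℝ))) (C + C)
    (fun n p => (p.2.abs_paramEval_le (g n)).trans (hgC n))
    (fun p => p.2.tendsto_paramEval hX g (C + C) hgC hg0) hε
  refine ⟨Set.range fun n => φ (2 * n + 1), ι, hι, w, fun i => φ (2 * n i + 1),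
    fun i => φ (2 * n i), hw, hw1, fun i => ⟨n i, rfl⟩, ?_, ?_⟩
  · rintro i ⟨m, hm⟩
    have := hφ.injective hm
    omega
  · refine csSup_le ⟨0, zero_mem_jfValues b Ω _⟩ fun r hr => ?_
    obtain ⟨p, hp, rfl⟩ := exists_isNormingParam_eq hR0.le hR _ hr
    rw [hp.paramEval_sum w fun i => g (n i)]
    refine le_trans (Finset.sum_le_sum fun i _ => ?_) (hlt ⟨p, hp⟩).le
    exact mul_le_mul_of_nonneg_left (le_abs_self _) (hw i)

lemma two_le_norm_sum_single_sub (A : Set ℕ) {ι : Type*} [Fintype ι] (w : ι → ℝ) (n n' : ι → ℕ)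
    (hw : ∑ i, w i = 1) (hn : ∀ i, n i ∈ A) (hn' : ∀ i, n' i ∉ A) :
    2 ≤ ‖∑ i, w i • ((lp.single 1 (n i) 1 : Ell1) - lp.single 1 (n' i) 1)‖ := by
  classical
  set x : Ell1 := ∑ i, w i • ((lp.single 1 (n i) 1 : Ell1) - lp.single 1 (n' i) 1) with hx
  let θ : ℕ → ℝ := fun j => if j ∈ A then 1 else -1
  have hsingle : ∀ k, HasSum (fun j => θ j * (lp.single 1 k 1 : Ell1) j) (θ k) := fun k => by
    have := hasSum_single (f := fun j => θ j * (lp.single 1 k 1 : Ell1) j) k fun j hj => by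
      simp [lp.single_apply, hj]
    simpa using this
  have hsum : HasSum (fun j => θ j * x j) 2 := by
    have h := hasSum_sum (s := Finset.univ)
      fun i _ => ((hsingle (n i)).sub (hsingle (n' i))).mul_left (w i)
    have h2 : ∑ i, w i * (θ (n i) - θ (n' i)) = 2 := by
      have : ∀ i, w i * (θ (n i) - θ (n' i)) = w i * 2 := fun i => by
        simp only [θ, hn i, hn' i, if_true, if_false]
        norm_num
      rw [Finset.sum_congr rfl fun i _ => this i, ← Finset.sum_mul, hw, one_mul]
    rw [h2] at h
    convert! h using 1
    funext j
    rw [hx, lp.coeFn_sum, Finset.sum_apply, Finset.mul_sum]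
    refine Finset.sum_congr rfl fun i _ => ?_
    simp only [lp.coeFn_smul, lp.coeFn_sub, Pi.smul_apply, Pi.sub_apply, smul_eq_mul]
    ring
  have hnorm := lp.hasSum_norm (p := 1) (by simp) x
  simp only [ENNReal.toReal_one, Real.rpow_one] at hnorm
  refine hasSum_le (fun j => ?_) hsum hnorm
  have hθ : ‖θ j‖ = 1 := by simp only [θ]; split_ifs <;> simp
  calc θ j * x j ≤ ‖θ j * x j‖ := Real.le_norm_self _
    _ = ‖x j‖ := by rw [norm_mul, hθ, one_mul]

end

end JamesFunctionSpace

end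

open JamesFunctionSpace in
theorem theorem1 {X : Type*} [NormedAddCommGroup X] [NormedSpace ℝ X] [CompleteSpace X]
    (hX : JamesFunctionSpace.IsReflexive X) (b : JamesFunctionSpace.OneSymmetricBasis X)
    {d : ℕ} (Ω : Set (Fin d → ℝ)) (hΩ : IsOpen Ω) (hΩb : Bornology.IsBounded Ω) :
    ¬ JamesFunctionSpace.ContainsIsomorphicCopy
      (JamesFunctionSpace.JF b Ω) JamesFunctionSpace.Ell1 := by
  rintro ⟨Y, ⟨Φ⟩⟩
  let T : Ell1 →L[ℝ] JF b Ω := Y.subtypeL.comp (Φ : Ell1 →L[ℝ] Y)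
  obtain ⟨M, hM, hlow⟩ : ∃ M : ℝ, 0 < M ∧ ∀ x, ‖x‖ ≤ M * ‖T x‖ := by
    refine ⟨‖(Φ.symm : Y →L[ℝ] Ell1)‖ + 1, by positivity, fun x => ?_⟩
    have h := (Φ.symm : Y →L[ℝ] Ell1).le_opNorm (Φ x)
    rw [ContinuousLinearEquiv.coe_coe, Φ.symm_apply_apply] at h
    exact h.trans (mul_le_mul_of_nonneg_right (by linarith) (norm_nonneg _))
  let u : ℕ → Ell1 := fun n => lp.single 1 n 1
  have hu : ∀ n, ‖u n‖ = 1 := fun n => by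
    simp [u, lp.norm_single]
  have hδ : 0 < 1 / (2 * M) := by positivity
  have happrox : ∀ n, ∃ f : PreJF b Ω, ‖T (u n) - (f : JF b Ω)‖ < 1 / (2 * M) := fun n => by
    obtain ⟨f, hf⟩ := UniformSpace.Completion.denseRange_coe.exists_dist_lt (T (u n)) hδ
    exact ⟨f, by rwa [dist_eq_norm] at hf⟩
  choose f hf using happrox
  have hbdd : ∀ n, jfNorm b Ω (PreJF.toL1 b Ω (f n)) ≤ ‖T‖ + 1 / (2 * M) := fun n => by
    rw [← PreJF.norm_def, ← UniformSpace.Completion.norm_coe]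
    have h1 := T.le_opNorm (u n)
    rw [hu, mul_one] at h1
    have h2 := norm_sub_norm_le (f n : JF b Ω) (T (u n))
    rw [norm_sub_rev] at h2
    linarith [hf n]
  obtain ⟨A, ι, _, w, n, n', hw, hw1, hn, hn', hsmall⟩ :=
    exists_convexCombination_sub_le hX b hΩb (fun n => PreJF.toL1 b Ω (f n)) _ hbdd hδ
  let z : PreJF b Ω := ∑ i, w i • (f (n i) - f (n' i))
  have hz : ‖(z : JF b Ω)‖ ≤ 1 / (2 * M) := by
    rw [UniformSpace.Completion.norm_coe, PreJF.norm_def]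
    simpa [z] using hsmall
  have hzc : (z : JF b Ω) = ∑ i, w i • ((f (n i) : JF b Ω) - (f (n' i) : JF b Ω)) := by
    have := map_sum (UniformSpace.Completion.toComplL (𝕜 := ℝ) (E := PreJF b Ω))
      (fun i => w i • (f (n i) - f (n' i))) Finset.univ
    exact this.trans (Finset.sum_congr rfl fun i _ => by rw [map_smul, map_sub]; rfl)
  let x : Ell1 := ∑ i, w i • (u (n i) - u (n' i))
  have hx : 2 ≤ ‖x‖ := two_le_norm_sum_single_sub A w n n' hw1 hn hn'
  have hTx : T x = ∑ i, w i • (T (u (n i)) - T (u (n' i))) := by simp [x]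
  have hdiff : ‖T x - z‖ ≤ 2 * (1 / (2 * M)) := by
    rw [hTx, hzc, ← Finset.sum_sub_distrib]
    have hterm : ∀ i, ‖w i • (T (u (n i)) - T (u (n' i))) -
        w i • ((f (n i) : JF b Ω) - (f (n' i) : JF b Ω))‖ ≤ w i * (2 * (1 / (2 * M))) := fun i => by
      rw [← smul_sub, norm_smul, Real.norm_of_nonneg (hw i), sub_sub_sub_comm]
      refine mul_le_mul_of_nonneg_left ((norm_sub_le _ _).trans ?_) (hw i)
      linarith [hf (n i), hf (n' i)]
    refine (norm_sum_le_of_le _ fun i _ => hterm i).trans ?_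
    rw [← Finset.sum_mul, hw1, one_mul]
  have hTx3 : ‖T x‖ ≤ 3 * (1 / (2 * M)) := by
    have := norm_le_norm_add_norm_sub' (T x) (z : JF b Ω)
    linarith
  have hfinal := (hx.trans (hlow x)).trans (mul_le_mul_of_nonneg_left hTx3 hM.le)
  have : M * (3 * (1 / (2 * M))) = 3 / 2 := by field_simp
  linarith
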